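/- **Setting.** Let $n$ be the security parameter. A function $\varepsilon:\mathbb N\to\mathbb R_{\ge 0}$ is negligible if $\varepsilon(n)p(n)\to 0$ for every polynomial $p$. Let $(\mathcal F,\mathcal G)$ be an extended noisy trapdoor claw-free function (ENTCF) family. Only the following properties of it are used; in particular no hardness property is assumed. For each $n$ there are a nonempty domain $\mathcal X\subseteq\{0,1\}^w$, images $\mathcal Y=\{0,1\}^m$, probabilistic generators $\mathrm{Gen}_{\mathcal F},\mathrm{Gen}_{\mathcal G}$ of pairs $(k,t_k)$ of bit strings, and distributions $f_{k,b}(x)$, $f'_{k,b}(x)$ (for claw-free keys) and $g_{k,b}(x)$ (for injective keys) on $\mathcal Y$, for $b\in\{0,1\}$, $x\in\mathcal X$, such that for all generated $(k,t_k)$: * (claw-free keys) a function $\mathrm{Inv}_{\mathcal F}$ satisfies $\mathrm{Inv}_{\mathcal F}(t_k,b,y)=x$ whenever $y\in\mathrm{Supp}\,f_{k,b}(x)$; the relation $f_{k,0}(x_0)=f_{k,1}(x_1)$ is a perfect matching of $\mathcal X$ with $\mathcal X$; for matched $(x_0,x_1)$ and $y\in \mathrm{Supp}\,f'_{k,b}(x_b)$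 one has $\mathrm{Inv}_{\mathcal F}(t_k,c,y)=x_c$ for both $c\in\{0,1\}$; and the squared Hellinger distance of $f_{k,b}(x)$ and $f'_{k,b}(x)$, averaged over $x\in\mathcal X$, is at most a negligible function of $n$ not depending on $k,b$; * (injective keys) a function $\mathrm{Inv}_{\mathcal G}$ satisfies $\mathrm{Inv}_{\mathcal G}(t_k,y)=(b,x)$ whenever $y\in \mathrm{Supp}\,g_{k,b}(x)$; * (sampling) there is one efficient family of circuits $\textsc{Samp}$ that maps $|k\rangle|b\rangle|0\rangle$ to $|k\rangle|b\rangle\,|\mathcal X|^{-1/2}\sum_{x\in\mathcal X,\,y}\sqrt{p_{k,b}(x)(y)}\,|x\rangle|y\rangle|0\rangle$ up to negligible error uniform in $k,b$, with $p=f'$ for claw-free and $p=g$ for injective keys. Here a family of circuits over the gates Hadamard, $\pi/8$-gate ($T$) and CNOT is efficient if a polynomial-time Turing machine outputs on input $1^n$ a description of the $n$-th circuit. From now on write $f_{k,b}$ also for $g_{k,b}$ if $k$ is an injective key. Let $\textsc{Chk}(k,y,b,x)=1$ if $x\in\mathcal X$ and $y\in\mathrm{Supp}\,f_{k,b}(x)$,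 and $0$ otherwise. Let $\hat x_b(k,y)$ be the $x$ with $\textsc{Chk}(k,y,b,x)=1$. For injective $k$ let $\hat b(k,y)$ be the bit $b$ for which $\hat x_b(k,y)$ exists. For claw-free $k$ let $\hat u(k,y,d)=d\cdot(\hat x_0(k,y)\oplus\hat x_1(k,y))$. An undefined value is regarded as different from every bit. **Protocol.** The verifier draws $\theta_1,\theta_2\in\{0,1\}$ uniformly and then $(k_i,t_{k_i})$, independently, from $\mathrm{Gen}_{\mathcal G}(1^n)$ if $\theta_i=0$ and from $\mathrm{Gen}_{\mathcal F}(1^n)$ if $\theta_i=1$. She sends $k_1,k_2$, receives $y_1,y_2\in\mathcal Y$, and chooses one of two round types with probability $\frac12$ each. * *Preimage round:* she receives $b_i\in\{0,1\}$ and $x_i\in\{0,1\}^w$ and accepts iff $\textsc{Chk}(k_i,y_i,b_i,x_i)=1$ for $i=1,2$. * *Hadamard round:* she receives $d_1,d_2\in\{0,1\}^w$, sends uniform questions $q_1,q_2\in\{0,1\}$, and receives $v_1,v_2\in\{0,1\}$. If $(\theta_1,\theta_2)=(0,0)$ she accepts. If $(\theta_1,\theta_2)=(0,1)$ she rejects iff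 $q_1=0$ and $\hat b(k_1,y_1)\ne v_1$, or $q_2=1$ and $\hat u(k_2,y_2,d_2)\ne v_2\oplus\hat b(k_1,y_1)$. If $(\theta_1,\theta_2)=(1,0)$ she rejects iff $q_1=1$ and $\hat u(k_1,y_1,d_1)\ne v_1\oplus \hat b(k_2,y_2)$, or $q_2=0$ and $\hat b(k_2,y_2)\ne v_2$. If $(\theta_1,\theta_2)=(1,1)$ she rejects iff $(q_1,q_2)=(0,1)$ and $\hat u(k_2,y_2,d_2)\ne v_1\oplus v_2$, or $(q_1,q_2)=(1,0)$ and $\hat u(k_1,y_1,d_1)\neq v_1\oplus v_2$. **Proposition (completeness).** There is an efficient quantum prover (all of whose operations are efficient families of circuits followed by measurements in the computational basis) that is accepted in this protocol with probability at least $1-\varepsilon(n)$ for a negligible function $\varepsilon$. Moreover, this prover behaves honestly: * Given $k_1,k_2$, he prepares, up to negligible error, the product over $i=1,2$ of the states $$\frac1{\sqrt{2|\mathcal X|}}\sum_{b\in\{0,1\}}\ \sum_{x\in\mathcal X,\;y\in\mathcal Y}\sqrt{f_{k_i,b}(x)(y)}\;|b\rangle|x\rangle|y\rangle$$ (with $|k_i\rangle$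 and zeroed work qubits alongside), measures both image registers and returns the outcomes $y_1,y_2$. * In a preimage round he measures the registers of $b$ and $x$ in the computational basis and returns the outcomes. * In a Hadamard round he measures both registers of $x$ in the Hadamard basis, which gives $d_1,d_2$, applies a controlled-$Z$ gate to the two qubits holding $b$, and measures the $i$-th of these in the computational basis if $q_i=0$ and in the Hadamard basis if $q_i=1$, which gives $v_1,v_2$. -/

import Mathlib

open scoped BigOperators Topology

namespace SelfTest

noncomputable section

/-! ### Bit strings and negligible functions -/

/-- Bit strings of length `n`. -/
abbrev BitString (n : ℕ) : Type := Fin n → Bool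

/-- The bit `d · x = ∑ⱼ dⱼ xⱼ mod 2`. -/
def dotBit {n : ℕ} (d x : BitString n) : Bool :=
  decide (Odd (Finset.univ.filter (fun j => d j = true ∧ x j = true)).card)

/-- Bitwise exclusive or. -/
def xorBits {n : ℕ} (x y : BitString n) : BitString n := fun j => xor (x j) (y j)

/-- A nonnegative function of the security parameter is negligible if its product with any
polynomial tends to zero. -/
def Negligible (ε : ℕ → ℝ) : Prop :=
  (∀ n, 0 ≤ ε n) ∧
    ∀ p : Polynomial ℝ, Filter.Tendsto (fun n : ℕ => ε n * p.eval (n : ℝ)) Filter.atTop (𝓝 0)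

/-- The squared Hellinger distance of two distributions on a finite set. -/
def hellingerSq {α : Type} [Fintype α] (p q : PMF α) : ℝ :=
  1 - ∑ a, Real.sqrt ((p a).toReal * (q a).toReal)

/-! ### Quantum circuits -/

/-- Gates from the fixed universal gate set Hadamard, `π/8`-gate, controlled-not, on qubits labelled
by `ι`. -/
inductive Gate (ι : Type) : Type
  | hadamard (i : ι) : Gate ι
  | phase (i : ι) : Gate ι
  | cnot (control target : ι) (h : control ≠ target) : Gate ι

/-- (Not necessarily normalised) pure states of the qubits labelled by `ι`, given by their
amplitudes in the computational basis. -/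
abbrev QState (ι : Type) : Type := (ι → Bool) → ℂ

/-- The squared norm of a state. -/
def mass {ι : Type} [Fintype ι] [DecidableEq ι] (ψ : QState ι) : ℝ := ∑ s, ‖ψ s‖ ^ 2

/-- The unitary action of a gate. -/
def Gate.apply {ι : Type} [DecidableEq ι] : Gate ι → QState ι → QState ι
  | .hadamard i, ψ => fun s =>
      (ψ (Function.update s i false) +
        (if s i = true then -1 else 1) * ψ (Function.update s i true)) / (Real.sqrt 2 : ℂ)
  | .phase i, ψ => fun s =>
      if s i = true then Complex.exp (Complex.I * (Real.pi / 4 : ℝ)) * ψ s else ψ s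
  | .cnot i j _, ψ => fun s =>
      if s i = true then ψ (Function.update s j (!(s j))) else ψ s

/-- A circuit is a list of gates; the head of the list is applied first. -/
abbrev Circuit (ι : Type) : Type := List (Gate ι)

def Circuit.run {ι : Type} [DecidableEq ι] (C : Circuit ι) (ψ : QState ι) : QState ι :=
  C.foldl (fun φ g => g.apply φ) ψ

open Classical in
/-- The unnormalised post-measurement state when a computational basis measurement yields an outcome
described by `p`; its `mass` is the probability of that outcome. -/
def postMeasure {ι : Type} (p : (ι → Bool) → Prop) (ψ : QState ι) : QState ι :=
  fun s => if p s then ψ s else 0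

/-- The qubits used for one of the two functions: a register for a key of length `l`, a single
qubit for the bit `b`, a register for a preimage of length `w`, a register for an image of length
`m`, and `a` work qubits. -/
inductive Wire (l w m a : ℕ) : Type
  | key (j : Fin l) : Wire l w m a
  | bit : Wire l w m a
  | pre (j : Fin w) : Wire l w m a
  | img (j : Fin m) : Wire l w m a
  | work (j : Fin a) : Wire l w m a
  deriving DecidableEq, Fintype

/-! ### Descriptions of circuits and uniformity -/

/-- The alphabet for descriptions of circuits. -/
inductive Letter : Type
  | tick | sep | hadamard | phase | cnot | first | second | key | bit | pre | img | work
  deriving DecidableEq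

/-- A natural number in unary, followed by an end marker. -/
def unary (j : ℕ) : List Letter := List.replicate j Letter.tick ++ [Letter.sep]

/-- The name of a wire: its register and its position therein. -/
def Wire.describe {l w m a : ℕ} : Wire l w m a → List Letter
  | .key j => Letter.key :: unary j
  | .bit => Letter.bit :: unary 0
  | .pre j => Letter.pre :: unary j
  | .img j => Letter.img :: unary j
  | .work j => Letter.work :: unary j

/-- The name of a wire when there is a copy of all registers for each of the two functions. -/
def describeTwo {l w m a : ℕ} (v : Fin 2 × Wire l w m a) : List Letter :=
  (if v.1 = 0 then Letter.first else Letter.second) :: v.2.describe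

def Gate.describe {ι : Type} (name : ι → List Letter) : Gate ι → List Letter
  | .hadamard i => Letter.hadamard :: name i
  | .phase i => Letter.phase :: name i
  | .cnot i j _ => Letter.cnot :: (name i ++ name j)

/-- The description of a circuit: the sizes of its registers and then its gates, in order. -/
def describeCircuit {ι : Type} (l w m a : ℕ) (name : ι → List Letter) (C : Circuit ι) :
    List Letter :=
  unary l ++ unary w ++ unary m ++ unary a ++ C.flatMap (fun g => g.describe name)

/-- A family of descriptions is uniform if some polynomial-time Turing machine outputs the `n`-th
one on input `1ⁿ`. -/
def Uniform (desc : ℕ → List Letter) : Prop :=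
  Nonempty (Turing.TM2ComputableInPolyTime (fun n : ℕ => List.replicate n ()) id desc)

/-! ### Trapdoor claw-free families -/

/-- The basis state in which the key register holds `k`, the qubit `bit` holds `b` and all other
qubits are `0`. -/
def sampInput {l w m a : ℕ} (k : BitString l) (b : Bool) : QState (Wire l w m a) :=
  Pi.single (fun v => match v with
    | .key j => k j
    | .bit => b
    | _ => false) 1

open Classical in
/-- The state `|k⟩ |b⟩ |X|^{-1/2} ∑_{x ∈ X, y} √(p x y) |x⟩ |y⟩ |0⟩`. -/
def sampOutput {l w m a : ℕ} (X : Finset (BitString w)) (p : BitString w → PMF (BitString m))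
    (k : BitString l) (b : Bool) : QState (Wire l w m a) := fun s =>
  if (fun j => s (.key j)) = k ∧ s .bit = b ∧ (fun j => s (.pre j)) ∈ X ∧
      (∀ j, s (.work j) = false) then
    ((Real.sqrt (p (fun j => s (.pre j)) (fun j => s (.img j))).toReal /
      Real.sqrt X.card : ℝ) : ℂ)
  else 0

/-- An extended noisy trapdoor claw-free function family with all its functional properties:
a claw-free family `f`, an injective family `g`, and one efficient procedure `samp` which serves
both. Computational hardness assumptions are not imposed, and neither is efficiency of the
procedures of the verifier, so that every ENTCF family is an instance. All finite sets consist of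
bit strings; elements of the domain are identified with their bit strings. A distribution on a set
of images is regarded as a distribution on all strings of length `imgLen n`, and the values of the
functions outside the domain are irrelevant. -/
structure ENTCFCore where
  /-- length of keys, of trapdoors, of preimages and of images -/
  keyLen : ℕ → ℕ
  trapLen : ℕ → ℕ
  preLen : ℕ → ℕ
  imgLen : ℕ → ℕ
  /-- the domain `𝒳` -/
  dom : ∀ n, Finset (BitString (preLen n))
  dom_nonempty : ∀ n, (dom n).Nonempty
  /-- the generation procedures for claw-free and for injective keys, with trapdoors -/
  genF : ∀ n, PMF (BitString (keyLen n) × BitString (trapLen n))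
  genG : ∀ n, PMF (BitString (keyLen n) × BitString (trapLen n))
  /-- the claw-free functions `f_{k,b}`, their approximations `f'_{k,b}`, the injective functions
  `g_{k,b}` -/
  f : ∀ n, BitString (keyLen n) → Bool → BitString (preLen n) → PMF (BitString (imgLen n))
  f' : ∀ n, BitString (keyLen n) → Bool → BitString (preLen n) → PMF (BitString (imgLen n))
  g : ∀ n, BitString (keyLen n) → Bool → BitString (preLen n) → PMF (BitString (imgLen n))
  /-- inversion with the trapdoor -/
  invF : ∀ n, BitString (trapLen n) → Bool → BitString (imgLen n) → BitString (preLen n)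
  invG : ∀ n, BitString (trapLen n) → BitString (imgLen n) → Bool × BitString (preLen n)
  invF_spec : ∀ n, ∀ kt ∈ (genF n).support, ∀ b, ∀ x ∈ dom n, ∀ y ∈ (f n kt.1 b x).support,
    invF n kt.2 b y = x
  /-- equality `f_{k,0}(x₀) = f_{k,1}(x₁)` is a perfect matching `R_k` of the domain -/
  matching_left : ∀ n, ∀ kt ∈ (genF n).support, ∀ x₀ ∈ dom n,
    ∃! x₁, x₁ ∈ dom n ∧ f n kt.1 false x₀ = f n kt.1 true x₁
  matching_right : ∀ n, ∀ kt ∈ (genF n).support, ∀ x₁ ∈ dom n,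
    ∃! x₀, x₀ ∈ dom n ∧ f n kt.1 false x₀ = f n kt.1 true x₁
  /-- on images sampled from `f'`, inversion finds both elements of the claw -/
  invF_spec' : ∀ n, ∀ kt ∈ (genF n).support, ∀ x : Bool → BitString (preLen n),
    (∀ b, x b ∈ dom n) → f n kt.1 false (x false) = f n kt.1 true (x true) →
    ∀ b, ∀ y ∈ (f' n kt.1 b (x b)).support, ∀ c, invF n kt.2 c y = x c
  /-- `f'` is close to `f` on average over the domain -/
  hellinger_le : ∃ ε, Negligible ε ∧ ∀ n, ∀ kt ∈ (genF n).support, ∀ b,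
    (∑ x ∈ dom n, hellingerSq (f n kt.1 b x) (f' n kt.1 b x)) / (dom n).card ≤ ε n
  /-- the trapdoor inverts the injective pair, so all the supports are disjoint -/
  invG_spec : ∀ n, ∀ kt ∈ (genG n).support, ∀ b, ∀ x ∈ dom n, ∀ y ∈ (g n kt.1 b x).support,
    invG n kt.2 y = (b, x)
  /-- the sampling circuits, their number of work qubits, their efficiency, and their action -/
  sampWork : ℕ → ℕ
  samp : ∀ n, Circuit (Wire (keyLen n) (preLen n) (imgLen n) (sampWork n))
  samp_uniform : Uniform (fun n =>
    describeCircuit (keyLen n) (preLen n) (imgLen n) (sampWork n) Wire.describe (samp n))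
  samp_spec : ∃ ε, Negligible ε ∧ ∀ n, ∀ b : Bool,
    (∀ kt ∈ (genF n).support,
      mass ((samp n).run (sampInput kt.1 b) - sampOutput (dom n) (f' n kt.1 b) kt.1 b) ≤ ε n) ∧
    (∀ kt ∈ (genG n).support,
      mass ((samp n).run (sampInput kt.1 b) - sampOutput (dom n) (g n kt.1 b) kt.1 b) ≤ ε n)

namespace ENTCFCore

variable (E : ENTCFCore) (n : ℕ)

abbrev Key : Type := BitString (E.keyLen n)
abbrev Trapdoor : Type := BitString (E.trapLen n)
abbrev Pre : Type := BitString (E.preLen n)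
abbrev Img : Type := BitString (E.imgLen n)

/-- The key generation for basis choice `θ`: injective for `θ = 0`, claw-free for `θ = 1`. -/
def gen (θ : Bool) : PMF (E.Key n × E.Trapdoor n) := if θ = true then E.genF n else E.genG n

/-- The functions belonging to keys for basis choice `θ`. -/
def fn (θ : Bool) : E.Key n → Bool → E.Pre n → PMF (E.Img n) :=
  if θ = true then E.f n else E.g n

/-- The condition `Chk(k, y, b, x) = 1` for a key of type `θ`. -/
def Chk (θ : Bool) (k : E.Key n) (y : E.Img n) (b : Bool) (x : E.Pre n) : Prop :=
  x ∈ E.dom n ∧ y ∈ (E.fn n θ k b x).support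

open Classical in
/-- The decoded bit `b̂(k, y)` of an injective key; `none` if `y` is not an image. -/
def bHat (k : E.Key n) (y : E.Img n) : Option Bool :=
  if h : ∃ b x, E.Chk n false k y b x then some h.choose else none

open Classical in
/-- The decoded preimage `x̂_b(k, y)` for a key of type `θ`; `none` stands for `⊥`. -/
def xHat (θ : Bool) (b : Bool) (k : E.Key n) (y : E.Img n) : Option (E.Pre n) :=
  if h : ∃ x, E.Chk n θ k y b x then some h.choose else none

/-- The bit `û(k, y, d) = d · (x̂₀(k, y) ⊕ x̂₁(k, y))` of a claw-free key; `none` if one of the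
preimages does not exist. -/
def uHat (k : E.Key n) (y : E.Img n) (d : E.Pre n) : Option Bool :=
  match E.xHat n true false k y, E.xHat n true true k y with
  | some x₀, some x₁ => some (dotBit d (xorBits x₀ x₁))
  | _, _ => none

/-- The condition under which the verifier raises no flag in a Hadamard round. Undefined decoded
bits differ from every answer. -/
def HadamardCheck (θ : Fin 2 → Bool) (k : Fin 2 → E.Key n) (y : Fin 2 → E.Img n)
    (d : Fin 2 → E.Pre n) (q v : Fin 2 → Bool) : Prop :=
  match θ 0, θ 1 with
  | false, false => True
  | false, true =>
      (q 0 = false → E.bHat n (k 0) (y 0) = some (v 0)) ∧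
      (q 1 = true → ∃ b, E.bHat n (k 0) (y 0) = some b ∧
        E.uHat n (k 1) (y 1) (d 1) = some (xor (v 1) b))
  | true, false =>
      (q 0 = true → ∃ b, E.bHat n (k 1) (y 1) = some b ∧
        E.uHat n (k 0) (y 0) (d 0) = some (xor (v 0) b)) ∧
      (q 1 = false → E.bHat n (k 1) (y 1) = some (v 1))
  | true, true =>
      (q 0 = false ∧ q 1 = true → E.uHat n (k 1) (y 1) (d 1) = some (xor (v 0) (v 1))) ∧
      (q 0 = true ∧ q 1 = false → E.uHat n (k 0) (y 0) (d 0) = some (xor (v 0) (v 1)))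

end ENTCFCore

/-! ### Provers -/

/-- A quantum prover. He holds two copies of the registers `key`, `bit`, `pre`, `img`, `work`.
On receiving the keys in the `key` registers (all else being `0`) he applies `prep`, measures the
registers `img` and returns the outcomes. In a preimage round he applies `preimage`, measures the
registers `bit` and `pre` and returns the outcomes. In a Hadamard round he applies `hadamard`,
measures the registers `pre` and returns the outcomes; on questions `q` he applies `answer q`,
measures the registers `bit` and returns the outcomes. All measurements are in the computational
basis, and the measured registers are kept. -/
structure Prover (E : ENTCFCore) where
  work : ℕ → ℕ
  prep : ∀ n, Circuit (Fin 2 × Wire (E.keyLen n) (E.preLen n) (E.imgLen n) (work n))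
  preimage : ∀ n, Circuit (Fin 2 × Wire (E.keyLen n) (E.preLen n) (E.imgLen n) (work n))
  hadamard : ∀ n, Circuit (Fin 2 × Wire (E.keyLen n) (E.preLen n) (E.imgLen n) (work n))
  answer : (Fin 2 → Bool) →
    ∀ n, Circuit (Fin 2 × Wire (E.keyLen n) (E.preLen n) (E.imgLen n) (work n))

namespace Prover

variable {E : ENTCFCore} (P : Prover E) (n : ℕ)

/-- The qubits of the prover. -/
abbrev Qubit : Type :=
  Fin 2 × Wire (E.keyLen n) (E.preLen n) (E.imgLen n) (P.work n)

/-- A family of circuits on the qubits of the prover is efficient. -/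
def Efficient (C : ∀ n, Circuit (P.Qubit n)) : Prop :=
  Uniform (fun n =>
    describeCircuit (E.keyLen n) (E.preLen n) (E.imgLen n) (P.work n) describeTwo (C n))

/-- An efficient prover. -/
def IsEfficient : Prop :=
  P.Efficient P.prep ∧ P.Efficient P.preimage ∧ P.Efficient P.hadamard ∧
    ∀ q, P.Efficient (P.answer q)

/-- The contents of the registers in a basis state. -/
def keyOf (s : P.Qubit n → Bool) (i : Fin 2) : E.Key n := fun j => s (i, .key j)
def bitOf (s : P.Qubit n → Bool) (i : Fin 2) : Bool := s (i, .bit)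
def preOf (s : P.Qubit n → Bool) (i : Fin 2) : E.Pre n := fun j => s (i, .pre j)
def imgOf (s : P.Qubit n → Bool) (i : Fin 2) : E.Img n := fun j => s (i, .img j)

/-- The state `|k₁⟩ |k₂⟩ |0⟩`. -/
def input (k : Fin 2 → E.Key n) : QState (P.Qubit n) :=
  Pi.single (fun v => match v with
    | (i, .key j) => k i j
    | _ => false) 1

/-- The unnormalised state after the prover has returned the images `y`. -/
def committed (k : Fin 2 → E.Key n) (y : Fin 2 → E.Img n) : QState (P.Qubit n) :=
  postMeasure (fun s => P.imgOf n s = y) ((P.prep n).run (P.input n k))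

/-- The joint probability of images `y` and answers `b`, `x` given that the round is a preimage
round. -/
def preimageProb (k : Fin 2 → E.Key n) (y : Fin 2 → E.Img n) (b : Fin 2 → Bool)
    (x : Fin 2 → E.Pre n) : ℝ :=
  mass (postMeasure (fun s => P.bitOf n s = b ∧ P.preOf n s = x)
    ((P.preimage n).run (P.committed n k y)))

/-- The joint probability of images `y`, strings `d` and answers `v` given that the round is a
Hadamard round with questions `q`. -/
def hadamardProb (k : Fin 2 → E.Key n) (y : Fin 2 → E.Img n) (d : Fin 2 → E.Pre n)
    (q v : Fin 2 → Bool) : ℝ :=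
  mass (postMeasure (fun s => P.bitOf n s = v)
    ((P.answer q n).run (postMeasure (fun s => P.preOf n s = d)
      ((P.hadamard n).run (P.committed n k y)))))

open Classical in
/-- The probability that the verifier raises no flag, given that the round is a preimage round. -/
def preimageAccept (θ : Fin 2 → Bool) (k : Fin 2 → E.Key n) : ℝ :=
  ∑ y : Fin 2 → E.Img n, ∑ b : Fin 2 → Bool, ∑ x : Fin 2 → E.Pre n,
    if ∀ i, E.Chk n (θ i) (k i) (y i) (b i) (x i) then P.preimageProb n k y b x else 0

open Classical in
/-- The probability that the verifier raises no flag, given that the round is a Hadamard round. -/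
def hadamardAccept (θ : Fin 2 → Bool) (k : Fin 2 → E.Key n) : ℝ :=
  ∑ q : Fin 2 → Bool, (1 / 4 : ℝ) *
    ∑ y : Fin 2 → E.Img n, ∑ d : Fin 2 → E.Pre n, ∑ v : Fin 2 → Bool,
      if E.HadamardCheck n θ k y d q v then P.hadamardProb n k y d q v else 0

/-- The probability that the prover is accepted in the self-testing protocol. -/
def acceptProb : ℝ :=
  ∑ θ : Fin 2 → Bool, (1 / 4 : ℝ) *
    ∑ kt : Fin 2 → E.Key n × E.Trapdoor n, (∏ i, (E.gen n (θ i) (kt i)).toReal) *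
      ((1 / 2 : ℝ) * P.preimageAccept n θ (fun i => (kt i).1) +
        (1 / 2 : ℝ) * P.hadamardAccept n θ (fun i => (kt i).1))

/-! ### The honest behaviour -/

open Classical in
/-- The tensor product over `i = 1, 2` of the states
`|kᵢ⟩ (2 |X|)^{-1/2} ∑_{b, x ∈ X, y} √(f_{kᵢ,b}(x)(y)) |b⟩ |x⟩ |y⟩ |0⟩`. -/
def honestState (θ : Fin 2 → Bool) (k : Fin 2 → E.Key n) : QState (P.Qubit n) := fun s =>
  ∏ i, if P.keyOf n s i = k i ∧ P.preOf n s i ∈ E.dom n ∧ ∀ j, s (i, .work j) = false then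
    ((Real.sqrt (E.fn n (θ i) (k i) (P.bitOf n s i) (P.preOf n s i) (P.imgOf n s i)).toReal /
      Real.sqrt (2 * (E.dom n).card) : ℝ) : ℂ)
  else 0

/-- Hadamard gates on all the qubits of both registers `pre`. -/
def hadamardAll : Circuit (P.Qubit n) :=
  (List.finRange 2).flatMap fun i =>
    (List.finRange (E.preLen n)).map fun j => Gate.hadamard (i, .pre j)

/-- The controlled-`Z` gate on the two qubits `bit`. -/
def controlledZ (ψ : QState (P.Qubit n)) : QState (P.Qubit n) := fun s =>
  if s (0, .bit) = true ∧ s (1, .bit) = true then -ψ s else ψ s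

/-- Hadamard gates on those qubits `bit` for which the question is the Hadamard basis. -/
def basisChange (q : Fin 2 → Bool) : Circuit (P.Qubit n) :=
  (List.finRange 2).flatMap fun i => if q i = true then [Gate.hadamard (i, .bit)] else []

/-- The honest prover: up to negligible error he prepares the state `honestState` before measuring
the images; in a preimage round he measures in the computational basis; in a Hadamard round he
measures the registers `pre` in the Hadamard basis, applies a controlled-`Z` gate to the two
qubits `bit`, and measures each of them in the basis requested by the question. -/
def IsHonest : Prop :=
  (∃ ε, Negligible ε ∧ ∀ (n : ℕ) (θ : Fin 2 → Bool) (kt : Fin 2 → E.Key n × E.Trapdoor n),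
    (∀ i, kt i ∈ (E.gen n (θ i)).support) →
      mass ((P.prep n).run (P.input n fun i => (kt i).1) -
        P.honestState n θ (fun i => (kt i).1)) ≤ ε n) ∧
  (∀ n ψ, (P.preimage n).run ψ = ψ) ∧
  (∀ n ψ, (P.hadamard n).run ψ = (P.hadamardAll n).run ψ) ∧
  (∀ q n ψ, (P.answer q n).run ψ = (P.basisChange n q).run (P.controlledZ n ψ))

end Prover

end

end SelfTest

open scoped BigOperators Topology

namespace SelfTest

noncomputable section

/-! ### Multi-pass transducers -/

/-! The prover applies a Hadamard gate to each qubit `bit` and then runs `samp` on each copy of the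
registers. Two things need proof: the ideal state passes every check with certainty, and the
circuits have uniform descriptions.

Passing the checks. Once images `y` are measured, the honest state is supported on basis states with
`Chk = 1`, which settles the preimage round. For an injective key the trapdoor shows that `bit` is
constantly `bHat` on this support. For a claw-free key the amplitudes do not change when the two
elements of the claw are exchanged, that is, when `bit` is flipped and `pre` is shifted by `x₀ ⊕
x₁`, because `f_{k,0}(x₀)` and `f_{k,1}(x₁)` are the same distribution (`measured_symmetric`). A
Hadamard gate trades a flip for a sign, so after `d` is measured, flipping `bit` multiplies the
state by `(-1)^u` with `u = d · (x₀ ⊕ x₁)` (`measuredTwice_flipBit`). The controlled-`Z` gate adds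
the other bit to the exponent (`controlledZ_symmetric`), and a last Hadamard gate forces the answer
to equal this exponent (`sign_mul_sign_eq_one`). The other bit is known either because it is
measured in the computational basis or because its key is injective. This is a stabilizer argument
carried out on amplitudes.

Robustness. The prepared state differs from the ideal one by the error of `samp` and by the
replacement of `f'` by `f`; the squared distance of the corresponding states is twice the averaged
squared Hellinger distance. The ideal state has no component on rejected outcomes, so the rejection
probability is at most the squared distance of the two states (`abs_sum_mass_sub_le`).

Uniformity. All that is known about `samp` and the register sizes is that some polynomial-time
machine prints their description. Each circuit family of the prover is therefore printed by that
machine followed by a finite transducer which rereads the description in linearly many sweeps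
(`Uniform.sweep`). -/

instance : Fintype Letter where
  elems := {.tick, .sep, .hadamard, .phase, .cnot, .first, .second, .key, .bit, .pre, .img, .work}
  complete := by intro x; cases x <;> decide

/-- A finite transducer that sweeps over a string several times. In each sweep every letter read
emits a string and is either kept for the next sweep or dropped; at the end of a sweep a last string
is emitted, and the next sweep starts in the state given by `next`. -/
structure Sweeper where
  Q : Type
  [fin : Fintype Q]
  start : Q
  step : Q → Letter → Q
  emit : Q → Letter → List Letter
  keep : Q → Letter → Bool
  final : Q → List Letter
  next : Q → Option Q

attribute [instance] Sweeper.fin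

namespace Sweeper

variable (T : Sweeper)

/-- The string emitted in a sweep. -/
def emitted : T.Q → List Letter → List Letter
  | q, [] => T.final q
  | q, c :: l => T.emit q c ++ emitted (T.step q c) l

/-- The string kept for the next sweep. -/
def kept : T.Q → List Letter → List Letter
  | _, [] => []
  | q, c :: l => (if T.keep q c then [c] else []) ++ kept (T.step q c) l

/-- `Sweeps q l out p`: starting in state `q` on the string `l`, the transducer emits `out` in `p`
sweeps, keeping nothing in the last one. -/
inductive Sweeps : T.Q → List Letter → List Letter → ℕ → Prop
  | last {q l} : T.next (l.foldl T.step q) = none → T.kept q l = [] →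
      Sweeps q l (T.emitted q l) 1
  | pass {q l q' out p} : T.next (l.foldl T.step q) = some q' → Sweeps q' (T.kept q l) out p →
      Sweeps q l (T.emitted q l ++ out) (p + 1)

variable {T}

theorem length_kept_le (q : T.Q) (l : List Letter) : (T.kept q l).length ≤ l.length := by
  induction l generalizing q with
  | nil => simp [kept]
  | cons c l ih =>
    have := ih (T.step q c)
    simp only [kept, List.length_append, List.length_cons]
    split_ifs <;> simp <;> omega

variable (T) in
/-- A bound for the length of the strings emitted in single steps. -/
def width : ℕ := (∑ q, ∑ c, (T.emit q c).length) + ∑ q, (T.final q).length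

theorem length_emit_le (q : T.Q) (c : Letter) : (T.emit q c).length ≤ T.width := by
  have h1 : (T.emit q c).length ≤ ∑ c, (T.emit q c).length :=
    Finset.single_le_sum (f := fun c => (T.emit q c).length) (fun _ _ => Nat.zero_le _)
      (Finset.mem_univ c)
  have h2 : ∑ c, (T.emit q c).length ≤ ∑ q, ∑ c, (T.emit q c).length :=
    Finset.single_le_sum (f := fun q => ∑ c, (T.emit q c).length) (fun _ _ => Nat.zero_le _)
      (Finset.mem_univ q)
  unfold width; omega

theorem length_final_le (q : T.Q) : (T.final q).length ≤ T.width := by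
  have h1 : (T.final q).length ≤ ∑ q, (T.final q).length :=
    Finset.single_le_sum (f := fun q => (T.final q).length) (fun _ _ => Nat.zero_le _)
      (Finset.mem_univ q)
  unfold width; omega

theorem length_emitted_le (q : T.Q) (l : List Letter) :
    (T.emitted q l).length ≤ T.width * (l.length + 1) := by
  induction l generalizing q with
  | nil => simpa [emitted] using length_final_le q
  | cons c l ih =>
    have h1 := ih (T.step q c)
    have h2 := length_emit_le q c
    simp only [emitted, List.length_append, List.length_cons]
    nlinarith

/-- The string never grows from one sweep to the next, so every sweep obeys the same bound. This
controls the time needed to move the output to its final stack. -/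
theorem Sweeps.length_le {q : T.Q} {l out : List Letter} {p N : ℕ} (h : T.Sweeps q l out p)
    (hl : l.length ≤ N) : out.length ≤ p * (T.width * (N + 1)) := by
  induction h with
  | @last q l _ _ =>
    have := length_emitted_le q l
    have : T.width * (l.length + 1) ≤ T.width * (N + 1) := Nat.mul_le_mul_left _ (by omega)
    omega
  | @pass q l q' out p _ _ ih =>
    have h1 := length_emitted_le q l
    have h2 : T.width * (l.length + 1) ≤ T.width * (N + 1) := Nat.mul_le_mul_left _ (by omega)
    have h3 := ih ((length_kept_le q l).trans hl)
    rw [List.length_append, Nat.add_mul]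
    omega

end Sweeper

/-! ### Reachability in a bounded number of steps -/

/-- `b` is reached from `a` in at most `m` steps. -/
def ReachesIn {σ : Type*} (f : σ → Option σ) (m : ℕ) (a b : σ) : Prop :=
  ∃ j ≤ m, (flip bind f)^[j] (some a) = some b

namespace ReachesIn

variable {σ : Type*} {f : σ → Option σ} {a b c : σ} {m n : ℕ}

theorem trans (h₁ : ReachesIn f m a b) (h₂ : ReachesIn f n b c) : ReachesIn f (m + n) a c := by
  obtain ⟨i, hi, h₁⟩ := h₁
  obtain ⟨j, hj, h₂⟩ := h₂
  exact ⟨j + i, by omega, by rw [Function.iterate_add_apply, h₁, h₂]⟩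

theorem mono (h : ReachesIn f m a b) (hmn : m ≤ n) : ReachesIn f n a b :=
  let ⟨j, hj, h⟩ := h
  ⟨j, hj.trans hmn, h⟩

theorem single (h : f a = some b) : ReachesIn f 1 a b := ⟨1, le_rfl, h⟩

theorem tail (h₁ : ReachesIn f m a b) (h : f b = some c) : ReachesIn f (m + 1) a c :=
  h₁.trans (single h)

theorem head (h : f a = some b) (h₂ : ReachesIn f m b c) : ReachesIn f (m + 1) a c :=
  ((single h).trans h₂).mono (by omega)

end ReachesIn

/-! ### Post-processing the output of a Turing machine -/

/-- The stacks of the post-processor: letters kept for the next sweep, the reversed output, and the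
output. -/
inductive AuxStack : Type
  | kept | rev | out
  deriving DecidableEq

instance : Fintype AuxStack where
  elems := {.kept, .rev, .out}
  complete := by intro x; cases x <;> decide

/-- The labels of a machine followed by a post-processor with state set `Q`. -/
inductive SweepLabel (Λ Q : Type) : Type
  | sim (l : Λ)
  | read (q : Q)
  | act (q : Q) (c : Letter)
  | fin (q : Q)
  | rewind (q : Q)
  | put (q : Q) (c : Letter)
  | flush
  | write (c : Letter)
  deriving Fintype

open Turing TM2.Stmt

/-- Push the letters of a string, in order. -/
def pushAll {K Λ σ : Type} {Γ : K → Type} (k : K) : List (Γ k) → TM2.Stmt Γ Λ σ → TM2.Stmt Γ Λ σ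
  | [], s => s
  | c :: l, s => push k (fun _ => c) (pushAll k l s)

theorem stepAux_pushAll {K Λ σ : Type} [DecidableEq K] {Γ : K → Type} (k : K) (l : List (Γ k))
    (s : TM2.Stmt Γ Λ σ) (v : σ) (S : ∀ k, List (Γ k)) :
    TM2.stepAux (pushAll k l s) v S =
      TM2.stepAux s v (Function.update S k (l.reverse ++ S k)) := by
  induction l generalizing S with
  | nil => simp [pushAll]
  | cons c l ih => simp [pushAll, ih]

/-- The number of pushes in a statement. -/
def pushCount {K Λ σ : Type} {Γ : K → Type} : TM2.Stmt Γ Λ σ → ℕ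
  | .push _ _ q => pushCount q + 1
  | .peek _ _ q => pushCount q
  | .pop _ _ q => pushCount q
  | .load _ q => pushCount q
  | .branch _ q₁ q₂ => pushCount q₁ + pushCount q₂
  | .goto _ => 0
  | .halt => 0

theorem length_stepAux_le {K Λ σ : Type} [DecidableEq K] {Γ : K → Type} (s : TM2.Stmt Γ Λ σ)
    (v : σ) (S : ∀ k, List (Γ k)) (k : K) :
    ((TM2.stepAux s v S).stk k).length ≤ (S k).length + pushCount s := by
  induction s generalizing v S with
  | push k' f q ih =>
    refine (ih _ _).trans ?_
    by_cases h : k = k'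
    · subst h; simp [pushCount, Nat.add_assoc, Nat.add_comm]
    · simp [h, pushCount]
  | peek k' f q ih => exact ih _ _
  | pop k' f q ih =>
    refine (ih _ _).trans ?_
    by_cases h : k = k'
    · subst h; simp [pushCount]
    · simp [h, pushCount]
  | load a q ih => exact ih _ _
  | branch f q₁ q₂ ih₁ ih₂ =>
    have h1 := ih₁ v S
    have h2 := ih₂ v S
    simp only [TM2.stepAux, pushCount]
    cases f v <;> simp only [cond_true, cond_false] <;> omega
  | goto l => simp [pushCount]
  | halt => simp [pushCount]

/-! ### Composition of a Turing machine with a sweeping post-processor -/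

section Machine

variable (M : FinTM2) (e : M.Γ M.k₁ ≃ Letter) (T : Sweeper)

/-- A bound for the number of pushes in one step of a machine. -/
def maxPush : ℕ := letI := M.ΛFin; ∑ l, pushCount (M.m l)

theorem length_step_le {c c' : M.Cfg} (h : M.step c = some c') (k : M.K) :
    (c'.stk k).length ≤ (c.stk k).length + maxPush M := by
  obtain ⟨l, v, S⟩ := c
  cases l with
  | none => simp [FinTM2.step] at h
  | some l =>
    obtain rfl : TM2.stepAux (M.m l) v S = c' := Option.some.inj h
    refine (length_stepAux_le _ _ _ _).trans (Nat.add_le_add_left ?_ _)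
    let := M.ΛFin
    exact Finset.single_le_sum (f := fun l => pushCount (M.m l)) (fun _ _ => Nat.zero_le _)
      (Finset.mem_univ l)

/-- A step adds at most `maxPush M` letters to a stack. Hence the output of a polynomial-time
machine has polynomial length, which bounds the cost of a sweep over it. -/
theorem length_iterate_le (j : ℕ) {c c' : M.Cfg}
    (h : (flip bind M.step)^[j] (some c) = some c') (k : M.K) :
    (c'.stk k).length ≤ (c.stk k).length + j * maxPush M := by
  induction j generalizing c' with
  | zero => simp only [Function.iterate_zero, id, Option.some.injEq] at h; subst h; simp
  | succ j ih =>
    rw [Function.iterate_succ_apply'] at h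
    obtain ⟨d, hd, h⟩ := Option.bind_eq_some_iff.1 h
    have h1 := ih hd
    have h2 := length_step_le M h k
    rw [Nat.add_mul]; omega

/-- The alphabets of the machine with post-processor. -/
abbrev sweepΓ : M.K ⊕ AuxStack → Type
  | .inl k => M.Γ k
  | .inr _ => Letter

/-- The configurations of the machine with post-processor. -/
abbrev SweepCfg : Type := TM2.Cfg (sweepΓ M) (SweepLabel M.Λ T.Q) (M.σ × Option Letter)

/-- The statements of the machine, followed by the post-processor. -/
def simStmt : TM2.Stmt M.Γ M.Λ M.σ →
    TM2.Stmt (sweepΓ M) (SweepLabel M.Λ T.Q) (M.σ × Option Letter)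
  | .push k f q => .push (.inl k) (fun v => f v.1) (simStmt q)
  | .peek k f q => .peek (.inl k) (fun v o => (f v.1 o, v.2)) (simStmt q)
  | .pop k f q => .pop (.inl k) (fun v o => (f v.1 o, v.2)) (simStmt q)
  | .load a q => .load (fun v => (a v.1, v.2)) (simStmt q)
  | .branch f q₁ q₂ => .branch (fun v => f v.1) (simStmt q₁) (simStmt q₂)
  | .goto l => .goto (fun v => .sim (l v.1))
  | .halt => .goto (fun _ => .read T.start)

/-- The program of the machine with post-processor. -/
def sweepProg : SweepLabel M.Λ T.Q →
    TM2.Stmt (sweepΓ M) (SweepLabel M.Λ T.Q) (M.σ × Option Letter)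
  | .sim l => simStmt M T (M.m l)
  -- The next label may depend only on the internal state, so the popped letter is stored in its
  -- second component; `none` there signals an empty stack.
  | .read q => .pop (.inl M.k₁) (fun v (o : Option (M.Γ M.k₁)) => (v.1, o.map e))
      (.goto fun v => v.2.elim (.fin q) (.act q))
  | .act q c => pushAll (Γ := sweepΓ M) (.inr .rev) (T.emit q c)
      (pushAll (Γ := sweepΓ M) (.inr .kept) (if T.keep q c then [c] else [])
        (.goto fun _ => .read (T.step q c)))
  | .fin q => pushAll (Γ := sweepΓ M) (.inr .rev) (T.final q)
      (.goto fun _ => (T.next q).elim .flush .rewind)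
  -- The kept letters lie on their stack in reverse order; moving them one by one back to the output
  -- stack of `M` restores the order for the next sweep.
  | .rewind q => .pop (.inr .kept) (fun v (o : Option Letter) => (v.1, o))
      (.goto fun v => v.2.elim (.read q) (.put q))
  | .put q c => pushAll (Γ := sweepΓ M) (.inl M.k₁) [e.symm c] (.goto fun _ => .rewind q)
  | .flush => .pop (.inr .rev) (fun v (o : Option Letter) => (v.1, o))
      (.branch (fun v => v.2.isNone) .halt (.goto fun v => v.2.elim .flush .write))
  | .write c => pushAll (Γ := sweepΓ M) (.inr .out) [c] (.goto fun _ => .flush)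

/-- The stacks of the machine with post-processor. -/
def sweepStk (S : ∀ k, List (M.Γ k)) (k r o : List Letter) :
    ∀ k, List (sweepΓ M k)
  | .inl i => S i
  | .inr .kept => k
  | .inr .rev => r
  | .inr .out => o

variable {M}

@[simp] theorem update_sweepStk_inl 
    (S : ∀ k, List (M.Γ k)) (k r o : List Letter) (i : M.K) (x : List (M.Γ i)) :
    Function.update (sweepStk M S k r o) (.inl i) x =
      sweepStk M (Function.update S i x) k r o := by
  funext j
  rcases j with j | j | j | j
  · by_cases h : j = i
    · subst h; simp [sweepStk]
    · simp [sweepStk, h]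
  all_goals simp [sweepStk]

@[simp] theorem update_sweepStk_kept 
    (S : ∀ k, List (M.Γ k)) (k r o x : List Letter) :
    Function.update (sweepStk M S k r o) (.inr .kept) x = sweepStk M S x r o := by
  funext j
  rcases j with j | j | j | j <;> simp [sweepStk]

@[simp] theorem update_sweepStk_rev 
    (S : ∀ k, List (M.Γ k)) (k r o x : List Letter) :
    Function.update (sweepStk M S k r o) (.inr .rev) x = sweepStk M S k x o := by
  funext j
  rcases j with j | j | j | j <;> simp [sweepStk]

@[simp] theorem update_sweepStk_out 
    (S : ∀ k, List (M.Γ k)) (k r o x : List Letter) :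
    Function.update (sweepStk M S k r o) (.inr .out) x = sweepStk M S k r x := by
  funext j
  rcases j with j | j | j | j <;> simp [sweepStk]

/-- A configuration of the machine as one of the machine with post-processor. -/
def simCfg (c : M.Cfg) : SweepCfg M T where
  l := some (c.l.elim (.read T.start) .sim)
  var := (c.var, none)
  stk := sweepStk M c.stk [] [] []

variable {e T}

/-- The simulation is step for step: it leaves the auxiliary stacks empty and the letter cache at
`none`, and a halting statement leads to the start of the first sweep. -/
theorem stepAux_simStmt (s : TM2.Stmt M.Γ M.Λ M.σ) (v : M.σ) (S : ∀ k, List (M.Γ k)) :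
    TM2.stepAux (simStmt M T s) (v, none) (sweepStk M S [] [] []) =
      simCfg T (TM2.stepAux s v S) := by
  induction s generalizing v S with
  | push k f q ih => simp [simStmt, ← ih, sweepStk]
  | peek k f q ih => simp [simStmt, ← ih, sweepStk]
  | pop k f q ih => simp [simStmt, ← ih, sweepStk]
  | load a q ih => simp [simStmt, ← ih]
  | branch f q₁ q₂ ih₁ ih₂ =>
    simp only [simStmt, TM2.stepAux]
    cases f v
    · exact ih₂ _ _
    · exact ih₁ _ _
  | goto l => rfl
  | halt => rfl

theorem step_simCfg {c c' : M.Cfg} (h : M.step c = some c') :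
    TM2.step (sweepProg M e T) (simCfg T c) = some (simCfg T c') := by
  obtain ⟨l, v, S⟩ := c
  cases l with
  | none => simp [FinTM2.step] at h
  | some l =>
    obtain rfl : TM2.stepAux (M.m l) v S = c' := Option.some.inj h
    exact congrArg some (stepAux_simStmt _ _ _)

theorem iterate_simCfg (j : ℕ) {c c' : M.Cfg}
    (h : (flip bind M.step)^[j] (some c) = some c') :
    (flip bind (TM2.step (sweepProg M e T)))^[j] (some (simCfg T c)) = some (simCfg T c') := by
  induction j generalizing c' with
  | zero => simp only [Function.iterate_zero, id, Option.some.injEq] at h ⊢; rw [h]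
  | succ j ih =>
    rw [Function.iterate_succ_apply'] at h
    obtain ⟨d, hd, h⟩ := Option.bind_eq_some_iff.1 h
    rw [Function.iterate_succ_apply', ih hd]
    exact step_simCfg h

variable (M) in
/-- The stacks of the machine when only the output stack is in use. -/
def outStk (l : List (M.Γ M.k₁)) : ∀ k, List (M.Γ k) := Function.update (fun _ => []) M.k₁ l

variable (T) in
/-- The configurations of the post-processor. -/
def sweepCfg (lab : SweepLabel M.Λ T.Q) (c : Option Letter) (l k r o : List Letter) :
    SweepCfg M T where
  l := some lab
  var := (M.initialState, c)
  stk := sweepStk M (outStk M (l.map e.symm)) k r o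

theorem sweepStk_inl (S : ∀ k, List (M.Γ k)) (k r o : List Letter) (i : M.K) :
    sweepStk M S k r o (.inl i) = S i := rfl

theorem sweepStk_kept (S : ∀ k, List (M.Γ k)) (k r o : List Letter) :
    sweepStk M S k r o (.inr .kept) = k := rfl

theorem sweepStk_rev (S : ∀ k, List (M.Γ k)) (k r o : List Letter) :
    sweepStk M S k r o (.inr .rev) = r := rfl

theorem sweepStk_out (S : ∀ k, List (M.Γ k)) (k r o : List Letter) :
    sweepStk M S k r o (.inr .out) = o := rfl

theorem outStk_self (l : List (M.Γ M.k₁)) : outStk M l M.k₁ = l := by simp [outStk]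

theorem update_outStk (l l' : List (M.Γ M.k₁)) :
    Function.update (outStk M l) M.k₁ l' = outStk M l' := by simp [outStk]

local notation "sweepStep" => TM2.step (sweepProg M e T)

theorem step_read_nil (q : T.Q) (c₀ : Option Letter) (k r o : List Letter) :
    sweepStep (sweepCfg (e := e) T (.read q) c₀ [] k r o) =
      some (sweepCfg (e := e) T (.fin q) none [] k r o) := by
  simp [sweepCfg, sweepProg, sweepStk_inl, outStk_self, update_outStk]

theorem step_read_cons (q : T.Q) (c₀ : Option Letter) (c : Letter) (l k r o : List Letter) :
    sweepStep (sweepCfg (e := e) T (.read q) c₀ (c :: l) k r o) =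
      some (sweepCfg (e := e) T (.act q c) (some c) l k r o) := by
  simp [sweepCfg, sweepProg, sweepStk_inl, outStk_self, update_outStk]

theorem step_act (q : T.Q) (c₀ : Option Letter) (c : Letter) (l k r o : List Letter) :
    sweepStep (sweepCfg (e := e) T (.act q c) c₀ l k r o) =
      some (sweepCfg (e := e) T (.read (T.step q c)) c₀ l
        ((if T.keep q c then [c] else []) ++ k) ((T.emit q c).reverse ++ r) o) := by
  cases h : T.keep q c <;>
    simp [sweepCfg, sweepProg, stepAux_pushAll, sweepStk_kept, sweepStk_rev, h]

theorem step_fin (q : T.Q) (c₀ : Option Letter) (l k r o : List Letter) :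
    sweepStep (sweepCfg (e := e) T (.fin q) c₀ l k r o) =
      some (sweepCfg (e := e) T ((T.next q).elim .flush .rewind) c₀ l k
        ((T.final q).reverse ++ r) o) := by
  simp [sweepCfg, sweepProg, stepAux_pushAll, sweepStk_rev]

theorem step_rewind_nil (q : T.Q) (c₀ : Option Letter) (l r o : List Letter) :
    sweepStep (sweepCfg (e := e) T (.rewind q) c₀ l [] r o) =
      some (sweepCfg (e := e) T (.read q) none l [] r o) := by
  simp [sweepCfg, sweepProg, sweepStk_kept]

theorem step_rewind_cons (q : T.Q) (c₀ : Option Letter) (c : Letter) (l k r o : List Letter) :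
    sweepStep (sweepCfg (e := e) T (.rewind q) c₀ l (c :: k) r o) =
      some (sweepCfg (e := e) T (.put q c) (some c) l k r o) := by
  simp [sweepCfg, sweepProg, sweepStk_kept]

theorem step_put (q : T.Q) (c₀ : Option Letter) (c : Letter) (l k r o : List Letter) :
    sweepStep (sweepCfg (e := e) T (.put q c) c₀ l k r o) =
      some (sweepCfg (e := e) T (.rewind q) c₀ (c :: l) k r o) := by
  simp [sweepCfg, sweepProg, stepAux_pushAll, sweepStk_inl, outStk_self, update_outStk]

theorem step_flush_nil (c₀ : Option Letter) (l k o : List Letter) :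
    sweepStep (sweepCfg (e := e) T .flush c₀ l k [] o) =
      some ⟨none, (M.initialState, none), sweepStk M (outStk M (l.map e.symm)) k [] o⟩ := by
  simp [sweepCfg, sweepProg, sweepStk_rev]

theorem step_flush_cons (c₀ : Option Letter) (c : Letter) (l k r o : List Letter) :
    sweepStep (sweepCfg (e := e) T .flush c₀ l k (c :: r) o) =
      some (sweepCfg (e := e) T (.write c) (some c) l k r o) := by
  simp [sweepCfg, sweepProg, sweepStk_rev]

theorem step_write (c₀ : Option Letter) (c : Letter) (l k r o : List Letter) :
    sweepStep (sweepCfg (e := e) T (.write c) c₀ l k r o) =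
      some (sweepCfg (e := e) T .flush c₀ l k r (c :: o)) := by
  simp [sweepCfg, sweepProg, stepAux_pushAll, sweepStk_out]

/-- A letter costs a `read` and an `act`; the end of the string costs a failing `read` and a `fin`.
Kept and emitted letters pile up in reverse order. -/
theorem reaches_sweep (q : T.Q) (c₀ : Option Letter) (l k r o : List Letter) :
    ∃ c₁, ReachesIn sweepStep (2 * l.length + 2) (sweepCfg (e := e) T (.read q) c₀ l k r o)
      (sweepCfg (e := e) T ((T.next (l.foldl T.step q)).elim .flush .rewind) c₁ []
        ((T.kept q l).reverse ++ k) ((T.emitted q l).reverse ++ r) o) := by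
  induction l generalizing q c₀ k r with
  | nil =>
    exact ⟨_, (ReachesIn.single (step_read_nil _ _ _ _ _)).tail (step_fin _ _ _ _ _ _)⟩
  | cons c l ih =>
    obtain ⟨c₁, h⟩ := ih (T.step q c) (some c) ((if T.keep q c then [c] else []) ++ k)
      ((T.emit q c).reverse ++ r)
    refine ⟨c₁, ?_⟩
    have h' := (h.head (step_act q (some c) c l k r o)).head (step_read_cons q c₀ c l k r o)
    have hk : (T.kept q (c :: l)).reverse ++ k = (T.kept (T.step q c) l).reverse ++
        ((if T.keep q c then [c] else []) ++ k) := by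
      cases h : T.keep q c <;> simp [Sweeper.kept, h]
    rw [hk, Sweeper.emitted, List.reverse_append, List.append_assoc]
    exact h'.mono (by simp only [List.length_cons]; omega)

theorem reaches_rewind (q : T.Q) (c₀ : Option Letter) (l k r o : List Letter) :
    ReachesIn sweepStep (2 * k.length + 1) (sweepCfg (e := e) T (.rewind q) c₀ l k r o)
      (sweepCfg (e := e) T (.read q) none (k.reverse ++ l) [] r o) := by
  induction k generalizing c₀ l with
  | nil => exact ReachesIn.single (step_rewind_nil _ _ _ _ _)
  | cons c k ih =>
    have h := ((ih (some c) (c :: l)).head (step_put q (some c) c l k r o)).head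
      (step_rewind_cons q c₀ c l k r o)
    simpa [Nat.mul_add, Nat.add_right_comm] using h

theorem reaches_flush (c₀ : Option Letter) (l k r o : List Letter) :
    ReachesIn sweepStep (2 * r.length + 1) (sweepCfg (e := e) T .flush c₀ l k r o)
      ⟨none, (M.initialState, none),
        sweepStk M (outStk M (l.map e.symm)) k [] (r.reverse ++ o)⟩ := by
  induction r generalizing c₀ o with
  | nil => exact ReachesIn.single (step_flush_nil _ _ _ _)
  | cons c r ih =>
    have h := ((ih (some c) (c :: o)).head (step_write (some c) c l k r o)).head
      (step_flush_cons c₀ c l k r o)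
    simpa [Nat.mul_add, Nat.add_right_comm] using h

/-- A sweep takes at most `2 * N + 2` steps and rewinding at most `2 * N + 1`, which gives `4 * N +
3` for each of the `p` sweeps. -/
theorem reaches_sweeps {q : T.Q} {l out : List Letter} {p N : ℕ} (h : T.Sweeps q l out p)
    (hl : l.length ≤ N) (c₀ : Option Letter) (r o : List Letter) :
    ∃ c₁, ReachesIn sweepStep (p * (4 * N + 3)) (sweepCfg (e := e) T (.read q) c₀ l [] r o)
      (sweepCfg (e := e) T .flush c₁ [] [] (out.reverse ++ r) o) := by
  induction h generalizing c₀ r with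
  | @last q l hn hk =>
    obtain ⟨c₁, h⟩ := reaches_sweep (e := e) q c₀ l [] r o
    rw [hn, hk] at h
    exact ⟨c₁, h.mono (by omega)⟩
  | @pass q l q' out p hn _ ih =>
    obtain ⟨c₁, h₁⟩ := reaches_sweep (e := e) q c₀ l [] r o
    rw [hn, List.append_nil] at h₁
    have h₂ := reaches_rewind (e := e) q' c₁ [] (T.kept q l).reverse ((T.emitted q l).reverse ++ r) o
    rw [List.reverse_reverse, List.append_nil] at h₂
    have hk := Sweeper.length_kept_le q l
    obtain ⟨c₂, h₃⟩ := ih (hk.trans hl) none ((T.emitted q l).reverse ++ r)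
    refine ⟨c₂, ?_⟩
    rw [List.reverse_append, List.append_assoc]
    refine ((h₁.trans h₂).trans h₃).mono ?_
    rw [List.length_reverse, Nat.add_mul]
    omega

variable (M e T) in
/-- A machine followed by a post-processor which sweeps over its output. -/
def sweepMachine : FinTM2 where
  K := M.K ⊕ AuxStack
  kDecidableEq := letI := M.kDecidableEq; inferInstance
  kFin := letI := M.kFin; inferInstance
  k₀ := .inl M.k₀
  k₁ := .inr .out
  Γ := sweepΓ M
  Λ := SweepLabel M.Λ T.Q
  main := .sim M.main
  ΛFin := letI := M.ΛFin; inferInstance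
  σ := M.σ × Option Letter
  initialState := (M.initialState, none)
  σFin := letI := M.σFin; inferInstance
  Γk₀Fin := M.Γk₀Fin
  m := sweepProg M e T


theorem initList_sweepMachine (l : List (M.Γ M.k₀)) :
    initList (sweepMachine M e T) l = simCfg T (initList M l) := by
  unfold initList simCfg
  congr 1
  funext k
  rcases k with k | k | k | k
  · by_cases h : k = M.k₀
    · subst h
      simp [sweepMachine, sweepStk]
      rfl
    · simp [sweepMachine, sweepStk, h]
  all_goals simp [sweepMachine, sweepStk]

/-- A machine halts with its internal state reset and all stacks empty but the output stack; this is
exactly a configuration from which the first sweep can start. -/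
theorem simCfg_haltList (l : List Letter) :
    simCfg T (haltList M (l.map e.symm)) =
      sweepCfg (e := e) T (.read T.start) none l [] [] [] := by
  unfold haltList simCfg sweepCfg
  congr 2
  funext k
  by_cases h : k = M.k₁
  · subst h; simp [outStk]
  · simp [outStk, h]

/-- The composed machine must also halt with all other stacks empty, which is why `Sweeps` demands
that the last sweep keep nothing. -/
theorem haltList_sweepMachine (l : List Letter) :
    haltList (sweepMachine M e T) l =
      ⟨none, (M.initialState, none), sweepStk M (outStk M []) [] [] l⟩ := by
  unfold haltList
  congr 1
  funext k
  rcases k with k | k | k | k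
  · by_cases h : k = M.k₁
    · subst h; simp [sweepMachine, sweepStk, outStk]
    · simp [sweepMachine, sweepStk, outStk, h]
  · simp [sweepMachine, sweepStk]
  · simp [sweepMachine, sweepStk]
  · simp [sweepMachine, sweepStk]
    rfl

theorem reachesIn_sweepMachine {m : ℕ} {l : List (M.Γ M.k₀)} {out : List Letter}
    (h : ReachesIn sweepStep m (simCfg T (initList M l))
      ⟨none, (M.initialState, none), sweepStk M (outStk M []) [] [] out⟩) :
    ReachesIn (sweepMachine M e T).step m (initList (sweepMachine M e T) l)
      (haltList (sweepMachine M e T) out) := by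
  obtain ⟨j, hj, h⟩ := h
  exact ⟨j, hj, (congrArg (fun c => (flip bind (sweepMachine M e T).step)^[j] (some c))
    (initList_sweepMachine l)).trans (h.trans (congrArg some (haltList_sweepMachine out).symm))⟩

variable (M) in
theorem length_initList_le (l : List (M.Γ M.k₀)) (k : M.K) :
    ((initList M l).stk k).length ≤ l.length := by
  by_cases h : k = M.k₀
  · subst h; simp [initList]
  · simp [initList, h]

end Machine

/-- If a polynomial-time machine prints the strings `desc n`, then so does one for the strings which
a finite transducer emits from them in linearly many sweeps. -/
theorem Uniform.sweep {desc out : ℕ → List Letter} (h : Uniform desc) (T : Sweeper)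
    (hT : ∀ n, ∃ p ≤ 2 * (desc n).length + 3, T.Sweeps T.start (desc n) (out n) p) :
    Uniform out := by
  obtain ⟨h⟩ := h
  let M := h.tm
  let e := h.outputAlphabet
  let C := maxPush M
  -- `N` bounds the length of `desc n` and `P` the number of sweeps. `R` adds up the simulation, the
  -- sweeps, and the final transfer of the output at two steps per letter.
  let N : Polynomial ℕ := Polynomial.X + h.time * Polynomial.C C
  let P : Polynomial ℕ := 2 * N + 3
  let R : Polynomial ℕ := h.time + P * (4 * N + 3) +
    (2 * (P * (Polynomial.C T.width * (N + 1))) + 1)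
  have key : ∀ n, ReachesIn (sweepMachine M e T).step (R.eval (List.replicate n ()).length)
      (initList (sweepMachine M e T)
        ((List.replicate n ()).map h.inputAlphabet.invFun))
      (haltList (sweepMachine M e T) (out n)) := by
    intro n
    set Z := List.replicate n ()
    have hsim := h.outputsFun n
    have hit : (flip bind M.step)^[hsim.steps]
        (some (initList M (Z.map h.inputAlphabet.invFun))) =
        some (haltList M ((desc n).map e.symm)) := hsim.evals_in_steps
    have hsteps : hsim.steps ≤ h.time.eval Z.length := hsim.steps_le_m
    have hlen : (desc n).length ≤ N.eval Z.length := by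
      have h1 := length_iterate_le M hsim.steps hit M.k₁
      have h2 : ((haltList M ((desc n).map e.symm)).stk M.k₁).length = (desc n).length := by
        simp [haltList]
      have h3 := length_initList_le M (Z.map h.inputAlphabet.invFun) M.k₁
      have h4 : hsim.steps * maxPush M ≤ h.time.eval Z.length * maxPush M :=
        Nat.mul_le_mul_right _ hsteps
      have h5 : N.eval Z.length = Z.length + h.time.eval Z.length * maxPush M := by simp [N, C]
      rw [h2] at h1
      rw [List.length_map] at h3
      omega
    obtain ⟨p, hp, hsw⟩ := hT n
    have hp' : p ≤ P.eval Z.length := by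
      have : P.eval Z.length = 2 * N.eval Z.length + 3 := by simp [P]
      omega
    have r1 : ReachesIn (TM2.step (sweepProg M e T)) (h.time.eval Z.length)
        (simCfg T (initList M (Z.map h.inputAlphabet.invFun)))
        (simCfg T (haltList M ((desc n).map e.symm))) :=
      ⟨hsim.steps, hsteps, iterate_simCfg _ hit⟩
    rw [simCfg_haltList] at r1
    obtain ⟨c₁, r2⟩ := reaches_sweeps (e := e) hsw hlen none [] []
    have hr := (r1.trans r2).trans
      (reaches_flush (e := e) (T := T) c₁ [] [] ((out n).reverse ++ []) [])
    simp only [List.append_nil, List.reverse_reverse, List.map_nil, List.length_reverse] at hr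
    refine reachesIn_sweepMachine (hr.mono ?_)
    have h1 := hsw.length_le hlen
    have h2 : p * (T.width * (N.eval Z.length + 1)) ≤
      P.eval Z.length * (T.width * (N.eval Z.length + 1)) := Nat.mul_le_mul_right _ hp'
    have h3 : p * (4 * N.eval Z.length + 3) ≤ P.eval Z.length * (4 * N.eval Z.length + 3) :=
      Nat.mul_le_mul_right _ hp'
    simp only [R, Polynomial.eval_add, Polynomial.eval_mul, Polynomial.eval_C,
      Polynomial.eval_one, Polynomial.eval_ofNat]
    omega
  refine ⟨{ tm := sweepMachine M e T, inputAlphabet := h.inputAlphabet,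
            outputAlphabet := Equiv.refl Letter, time := R,
            outputsFun := fun n =>
              ⟨⟨(key n).choose, ?_⟩, (key n).choose_spec.1⟩ }⟩
  refine (key n).choose_spec.2.trans ?_
  simp only [Option.map_some, id]
  exact congrArg (fun l => some (haltList (sweepMachine M e T) l)) (List.map_id _).symm

/-! ### Transducers for the circuits of the honest prover -/

namespace Sweeper

variable {T : Sweeper}

theorem emitted_replicate_tick {q : T.Q} (hs : T.step q .tick = q) (he : T.emit q .tick = [.tick])
    (j : ℕ) (l : List Letter) : T.emitted q (List.replicate j .tick ++ l) =
      List.replicate j .tick ++ T.emitted q l := by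
  induction j with
  | zero => rfl
  | succ j ih => simp [List.replicate_succ, emitted, hs, he, ih]

theorem emitted_replicate_tick_nil {q : T.Q} (hs : T.step q .tick = q) (he : T.emit q .tick = [])
    (j : ℕ) (l : List Letter) :
    T.emitted q (List.replicate j .tick ++ l) = T.emitted q l := by
  induction j with
  | zero => rfl
  | succ j ih => simp [List.replicate_succ, emitted, hs, he, ih]

theorem emitted_unary {q : T.Q} (hs : T.step q .tick = q) (he : T.emit q .tick = [.tick])
    (j : ℕ) (l : List Letter) : T.emitted q (unary j ++ l) =
      List.replicate j .tick ++ (T.emit q .sep ++ T.emitted (T.step q .sep) l) := by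
  rw [unary, List.append_assoc, emitted_replicate_tick hs he]; rfl

theorem emitted_unary_nil {q : T.Q} (hs : T.step q .tick = q) (he : T.emit q .tick = [])
    (j : ℕ) (l : List Letter) : T.emitted q (unary j ++ l) =
      T.emit q .sep ++ T.emitted (T.step q .sep) l := by
  rw [unary, List.append_assoc, emitted_replicate_tick_nil hs he]; rfl

theorem kept_replicate_tick {q : T.Q} (hs : T.step q .tick = q) (j : ℕ) (l : List Letter) :
    T.kept q (List.replicate j .tick ++ l) =
      (if T.keep q .tick then List.replicate j .tick else []) ++ T.kept q l := by
  induction j with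
  | zero => simp
  | succ j ih => cases h : T.keep q .tick <;> simp [List.replicate_succ, kept, hs, ih, h]

theorem kept_unary {q : T.Q} (hs : T.step q .tick = q) (j : ℕ) (l : List Letter) :
    T.kept q (unary j ++ l) = (if T.keep q .tick then List.replicate j .tick else []) ++
      ((if T.keep q .sep then [.sep] else []) ++ T.kept (T.step q .sep) l) := by
  rw [unary, List.append_assoc, kept_replicate_tick hs]; rfl

theorem foldl_unary {q : T.Q} (hs : T.step q .tick = q) (j : ℕ) (l : List Letter) :
    (unary j ++ l).foldl T.step q = l.foldl T.step (T.step q .sep) := by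
  have h : (List.replicate j Letter.tick).foldl T.step q = q := by
    induction j with
    | zero => rfl
    | succ j ih => rw [List.replicate_succ, List.foldl_cons, hs, ih]
  rw [unary, List.append_assoc, List.foldl_append, h]; rfl

theorem emitted_of_fixed {q : T.Q} (hs : ∀ c, T.step q c = q) (l : List Letter) :
    T.emitted q l = l.flatMap (T.emit q) ++ T.final q := by
  induction l with
  | nil => rfl
  | cons c l ih => simp [emitted, hs, ih]

theorem foldl_of_fixed {q : T.Q} (hs : ∀ c, T.step q c = q) (l : List Letter) :
    l.foldl T.step q = q := by
  induction l with
  | nil => rfl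
  | cons c l ih => rw [List.foldl_cons, hs, ih]

theorem kept_eq_nil {P : T.Q → Prop} (hs : ∀ q c, P q → P (T.step q c))
    (hk : ∀ q c, P q → T.keep q c = false) (l : List Letter) (q : T.Q) (hq : P q) :
    T.kept q l = [] := by
  induction l generalizing q with
  | nil => rfl
  | cons c l ih => simp [kept, hk q c hq, ih _ (hs q c hq)]

theorem kept_eq_self {P : T.Q → Prop} (hs : ∀ q c, P q → P (T.step q c))
    (hk : ∀ q c, P q → T.keep q c = true) (l : List Letter) (q : T.Q) (hq : P q) :
    T.kept q l = l := by
  induction l generalizing q with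
  | nil => rfl
  | cons c l ih => simp [kept, hk q c hq, ih _ (hs q c hq)]

end Sweeper

/-- The description of the sizes of the registers. -/
def header (l w m a : ℕ) : List Letter := unary l ++ unary w ++ unary m ++ unary a

/-- Counting the numbers in the header that have been read. -/
def headerStep (q : Fin 5) (c : Letter) : Fin 5 :=
  if q = 4 then 4 else if c = .sep then q + 1 else q

/-- The transducer which replaces everything after the header by `tail`. -/
abbrev tailSweeper (tail : List Letter) : Sweeper where
  Q := Fin 5
  start := 0
  step := headerStep
  emit q c := if q = 4 then [] else [c]
  keep _ _ := false
  final _ := tail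
  next _ := none

theorem sweeps_tailSweeper (tail : List Letter) (l w m a : ℕ) (G : List Letter) :
    (tailSweeper tail).Sweeps (0 : Fin 5) (header l w m a ++ G) (header l w m a ++ tail) 1 := by
  have h : (tailSweeper tail).emitted (0 : Fin 5) (header l w m a ++ G) =
      header l w m a ++ tail := by
    simp only [header, List.append_assoc]
    rw [Sweeper.emitted_unary rfl rfl, Sweeper.emitted_unary rfl rfl,
      Sweeper.emitted_unary rfl rfl, Sweeper.emitted_unary rfl rfl,
      Sweeper.emitted_of_fixed (fun _ => rfl)]
    simp [unary, headerStep]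
  rw [← h]
  exact .last rfl
    (Sweeper.kept_eq_nil (P := fun _ => True) (by simp) (by simp) _ _ trivial)

/-- The letter naming one of the two copies of the registers. -/
def ordinal (p : Bool) : Letter := if p then .second else .first

/-- Insert the name of a copy before the name of a register. -/
def relabel (p : Bool) : Letter → List Letter
  | .key => [ordinal p, .key]
  | .bit => [ordinal p, .bit]
  | .pre => [ordinal p, .pre]
  | .img => [ordinal p, .img]
  | .work => [ordinal p, .work]
  | c => [c]

/-- The description of a Hadamard gate on the qubit `bit` of a copy. -/
def hadamardBit (p : Bool) : List Letter := [.hadamard, ordinal p, .bit, .sep]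

/-- The transducer which describes a circuit on both copies of the registers, preceded by a Hadamard
gate on `bit`. -/
abbrev doubleSweeper : Sweeper where
  Q := Bool × Fin 5
  start := (false, 0)
  step q c := (q.1, headerStep q.2 c)
  -- State 4 means that the header is over. Only the first sweep copies the header; in both sweeps
  -- the separator read in state 3 ends it, so the Hadamard gate is inserted right there.
  emit q c := if q.2 = 4 then relabel q.1 c else
    (if q.1 then [] else [c]) ++ (if q.2 = 3 ∧ c = .sep then hadamardBit q.1 else [])
  keep q _ := !q.1
  final _ := []
  next q := if q.1 then none else some (true, 0)

theorem foldl_doubleSweeper_fst (p : Bool) (q : Fin 5) (l : List Letter) :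
    (l.foldl doubleSweeper.step (p, q)).1 = p := by
  induction l generalizing q with
  | nil => rfl
  | cons c l ih => exact ih _

theorem sweeps_doubleSweeper (l w m a : ℕ) (G : List Letter) :
    doubleSweeper.Sweeps ((false, 0) : Bool × Fin 5) (header l w m a ++ G)
      (header l w m a ++ ((hadamardBit false ++ G.flatMap (relabel false)) ++
        (hadamardBit true ++ G.flatMap (relabel true)))) 2 := by
  have h0 : doubleSweeper.emitted ((false, 0) : Bool × Fin 5) (header l w m a ++ G) =
      header l w m a ++ (hadamardBit false ++ G.flatMap (relabel false)) := by
    simp only [header, List.append_assoc]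
    rw [Sweeper.emitted_unary rfl rfl, Sweeper.emitted_unary rfl rfl,
      Sweeper.emitted_unary rfl rfl, Sweeper.emitted_unary rfl rfl,
      Sweeper.emitted_of_fixed (fun _ => rfl)]
    simp [unary, headerStep]
  have h1 : doubleSweeper.emitted ((true, 0) : Bool × Fin 5) (header l w m a ++ G) =
      hadamardBit true ++ G.flatMap (relabel true) := by
    simp only [header, List.append_assoc]
    rw [Sweeper.emitted_unary_nil rfl rfl, Sweeper.emitted_unary_nil rfl rfl,
      Sweeper.emitted_unary_nil rfl rfl, Sweeper.emitted_unary_nil rfl rfl,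
      Sweeper.emitted_of_fixed (fun _ => rfl)]
    simp [headerStep]
  rw [← List.append_assoc, ← h0, ← h1]
  refine .pass (q' := ((true, 0) : Bool × Fin 5)) ?_ ?_
  · exact if_neg (Bool.eq_false_iff.1 (foldl_doubleSweeper_fst _ _ _))
  · rw [Sweeper.kept_eq_self (P := fun q : Bool × Fin 5 => q.1 = false) (by simp) (by simp) _ _ rfl]
    refine .last ?_ ?_
    · exact if_pos (foldl_doubleSweeper_fst _ _ _)
    · exact Sweeper.kept_eq_nil (P := fun q : Bool × Fin 5 => q.1 = true) (by simp) (by simp) _ _ rfl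

/-- The description of Hadamard gates on the first `w` qubits of both registers `pre`, in
descending order. -/
def hadamardPre : ℕ → List Letter
  | 0 => []
  | w + 1 => [.hadamard, .first, .pre] ++ unary w ++ ([.hadamard, .second, .pre] ++ unary w ++
      hadamardPre w)

/-- The transducer which replaces everything after the header by a description of Hadamard gates on
all qubits of both registers `pre`. In the states `inr (p, busy)` it describes a gate on the copy
`p`, whose position is one less than the number of letters, and drops a letter if `p` is true. -/
abbrev hadamardSweeper : Sweeper where
  Q := Fin 5 ⊕ Bool × Bool
  start := .inl 0
  step q c := q.elim (fun q => .inl (headerStep q c)) (fun q => .inr (q.1, true))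
  -- The first tick of a sweep is replaced by the beginning of the gate; the remaining ticks and the
  -- final separator spell the position in unary.
  emit q c := q.elim (fun q => if q = 4 then [] else [c])
    (fun q => if q.2 then [.tick] else [.hadamard, ordinal q.1, .pre])
  -- The header sweep keeps just the ticks of its second number, the length of `pre`. Later the
  -- counter drops by one after both copies have been served.
  keep q c := q.elim (fun q => decide (q = 1 ∧ c = .tick)) (fun q => !q.1 || q.2)
  final q := q.elim (fun _ => []) (fun q => if q.2 then [.sep] else [])
  next q := q.elim (fun _ => some (.inr (false, false)))
    (fun q => if q.2 then some (.inr (!q.1, false)) else none)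

/-- Each position takes one sweep per copy, and a last sweep over the empty string stops the process
because it never becomes busy. -/
theorem sweeps_hadamardSweeper_gates (w : ℕ) :
    hadamardSweeper.Sweeps (.inr (false, false) : Fin 5 ⊕ Bool × Bool)
      (List.replicate w .tick) (hadamardPre w) (2 * w + 1) := by
  induction w with
  | zero => exact .last rfl rfl
  | succ w ih =>
    have hf : ∀ p, (List.replicate w Letter.tick).foldl hadamardSweeper.step
        (.inr (p, true) : Fin 5 ⊕ Bool × Bool) = .inr (p, true) := fun p =>
      Sweeper.foldl_of_fixed (T := hadamardSweeper) (fun _ => rfl) _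
    have he : ∀ p, hadamardSweeper.emitted (.inr (p, false) : Fin 5 ⊕ Bool × Bool)
        (List.replicate (w + 1) .tick) = [.hadamard, ordinal p, .pre] ++ unary w := by
      intro p
      have := Sweeper.emitted_replicate_tick (T := hadamardSweeper)
        (q := (.inr (p, true) : Fin 5 ⊕ Bool × Bool)) rfl rfl w []
      rw [List.append_nil] at this
      rw [List.replicate_succ, Sweeper.emitted]
      exact congrArg _ this
    have hk : ∀ p, hadamardSweeper.kept (.inr (p, true) : Fin 5 ⊕ Bool × Bool)
        (List.replicate w .tick) = List.replicate w .tick := by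
      intro p
      have := Sweeper.kept_replicate_tick (T := hadamardSweeper)
        (q := (.inr (p, true) : Fin 5 ⊕ Bool × Bool)) rfl w []
      simpa [Sweeper.kept] using this
    have h1 := he false
    have h2 := he true
    rw [hadamardPre]
    change hadamardSweeper.Sweeps _ _ (([.hadamard, ordinal false, .pre] ++ unary w) ++
      (([.hadamard, ordinal true, .pre] ++ unary w) ++ hadamardPre w)) (2 * w + 1 + 1 + 1)
    rw [← h1, ← h2]
    refine .pass (q' := (.inr (true, false) : Fin 5 ⊕ Bool × Bool)) ?_ ?_
    · rw [List.replicate_succ, List.foldl_cons]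
      exact congrArg hadamardSweeper.next (hf false)
    · have : hadamardSweeper.kept (.inr (false, false) : Fin 5 ⊕ Bool × Bool)
          (List.replicate (w + 1) .tick) = List.replicate (w + 1) .tick := by
        rw [List.replicate_succ, Sweeper.kept]
        exact congrArg (List.cons Letter.tick) (hk false)
      rw [this]
      refine .pass (q' := (.inr (false, false) : Fin 5 ⊕ Bool × Bool)) ?_ ?_
      · rw [List.replicate_succ, List.foldl_cons]
        exact congrArg hadamardSweeper.next (hf true)
      · have : hadamardSweeper.kept (.inr (true, false) : Fin 5 ⊕ Bool × Bool)
            (List.replicate (w + 1) .tick) = List.replicate w .tick := by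
          rw [List.replicate_succ, Sweeper.kept]
          exact hk true
        rw [this]
        exact ih

theorem sweeps_hadamardSweeper (l w m a : ℕ) (G : List Letter) :
    hadamardSweeper.Sweeps (.inl 0 : Fin 5 ⊕ Bool × Bool) (header l w m a ++ G)
      (header l w m a ++ hadamardPre w) (2 * w + 2) := by
  have h : hadamardSweeper.emitted (.inl 0 : Fin 5 ⊕ Bool × Bool) (header l w m a ++ G) =
      header l w m a := by
    simp only [header, List.append_assoc]
    rw [Sweeper.emitted_unary rfl rfl, Sweeper.emitted_unary rfl rfl,
      Sweeper.emitted_unary rfl rfl, Sweeper.emitted_unary rfl rfl,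
      Sweeper.emitted_of_fixed (fun _ => rfl)]
    simp [unary, headerStep]
  have hk : hadamardSweeper.kept (.inl 0 : Fin 5 ⊕ Bool × Bool) (header l w m a ++ G) =
      List.replicate w .tick := by
    simp only [header, List.append_assoc]
    rw [Sweeper.kept_unary rfl, Sweeper.kept_unary rfl, Sweeper.kept_unary rfl,
      Sweeper.kept_unary rfl, Sweeper.kept_eq_nil (P := fun q : Fin 5 ⊕ Bool × Bool => q = .inl 4)
      (by rintro q c rfl; rfl) (by rintro q c rfl; rfl)]
    · simp [headerStep]
    · rfl
  have hf : (header l w m a ++ G).foldl hadamardSweeper.step (.inl 0 : Fin 5 ⊕ Bool × Bool) =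
      .inl 4 := by
    simp only [header, List.append_assoc]
    exact (Sweeper.foldl_unary (T := hadamardSweeper) rfl _ _).trans <|
      (Sweeper.foldl_unary (T := hadamardSweeper) rfl _ _).trans <|
      (Sweeper.foldl_unary (T := hadamardSweeper) rfl _ _).trans <|
      (Sweeper.foldl_unary (T := hadamardSweeper) rfl _ _).trans <|
      Sweeper.foldl_of_fixed (T := hadamardSweeper) (fun _ => rfl) _
  nth_rw 2 [← h]
  refine .pass (q' := (.inr (false, false) : Fin 5 ⊕ Bool × Bool)) ?_ ?_
  · rw [hf]; rfl
  · rw [hk]; exact sweeps_hadamardSweeper_gates w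

/-! ### Circuits on both copies of the registers -/

/-- A gate on one of the two copies of the registers. -/
def Gate.copy {ι : Type} (i : Fin 2) : Gate ι → Gate (Fin 2 × ι)
  | .hadamard v => .hadamard (i, v)
  | .phase v => .phase (i, v)
  | .cnot u v h => .cnot (i, u) (i, v) (fun e => h (congrArg Prod.snd e))

theorem flatMap_relabel_unary (p : Bool) (j : ℕ) :
    (unary j).flatMap (relabel p) = unary j := by
  have h : (List.replicate j Letter.tick).flatMap (relabel p) = List.replicate j .tick := by
    induction j with
    | zero => rfl
    | succ j ih => rw [List.replicate_succ, List.flatMap_cons, ih]; rfl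
  rw [unary, List.flatMap_append, h]; rfl

/-- A register letter occurs only at the head of a wire name, so a letter-by-letter substitution,
which a finite transducer can perform, renames all wires to those of one copy. -/
theorem describeTwo_eq {l w m a : ℕ} (p : Bool) (v : Wire l w m a) :
    describeTwo ((if p then 1 else 0 : Fin 2), v) = v.describe.flatMap (relabel p) := by
  cases p <;> cases v <;>
    simp [describeTwo, Wire.describe, flatMap_relabel_unary, relabel, ordinal]

theorem describe_copy {l w m a : ℕ} (p : Bool) (g : Gate (Wire l w m a)) :
    (g.copy (if p then 1 else 0)).describe describeTwo =
      (g.describe Wire.describe).flatMap (relabel p) := by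
  cases g <;> simp only [Gate.copy, Gate.describe, describeTwo_eq, List.flatMap_cons,
    List.flatMap_append] <;> rfl

theorem flatMap_describe_map_copy {l w m a : ℕ} (p : Bool) (C : Circuit (Wire l w m a)) :
    (C.map (Gate.copy (if p then 1 else 0))).flatMap (fun g => g.describe describeTwo) =
      (C.flatMap fun g => g.describe Wire.describe).flatMap (relabel p) := by
  rw [List.flatMap_map, List.flatMap_assoc]
  exact congrArg (fun f => List.flatMap f C) (funext fun g => describe_copy p g)

/-- Hadamard gates on all qubits of both registers `pre`, in descending order. -/
def hadamardPreCircuit (l w m a : ℕ) : Circuit (Fin 2 × Wire l w m a) :=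
  (List.finRange w).reverse.flatMap fun j => [.hadamard (0, .pre j), .hadamard (1, .pre j)]

theorem flatMap_describe_hadamardPreCircuit (l w m a : ℕ) :
    (hadamardPreCircuit l w m a).flatMap (fun g => g.describe describeTwo) = hadamardPre w := by
  have h : ∀ w, hadamardPre w = (List.range w).reverse.flatMap fun j =>
      [.hadamard, .first, .pre] ++ unary j ++ ([.hadamard, .second, .pre] ++ unary j) := by
    intro w
    induction w with
    | zero => rfl
    | succ w ih => simp [hadamardPre, List.range_succ, ih]
  rw [h, ← List.map_coe_finRange_eq_range, ← List.map_reverse, List.flatMap_map,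
    hadamardPreCircuit, List.flatMap_assoc]
  refine congrArg (fun f => List.flatMap f _) (funext fun j => ?_)
  simp [Gate.describe, describeTwo, Wire.describe]

/-- The circuit on both copies which applies a Hadamard gate to `bit` and then a given circuit. -/
def prepCircuit {l w m a : ℕ} (C : Circuit (Wire l w m a)) : Circuit (Fin 2 × Wire l w m a) :=
  (.hadamard .bit :: C).map (Gate.copy 0) ++ (.hadamard .bit :: C).map (Gate.copy 1)

/-- A controlled-`Z` gate on the qubits `bit`, followed by Hadamard gates according to `q`. -/
def answerCircuit {l w m a : ℕ} (q : Fin 2 → Bool) : Circuit (Fin 2 × Wire l w m a) :=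
  [.hadamard (1, .bit), .cnot (0, .bit) (1, .bit) (by simp), .hadamard (1, .bit)] ++
    (List.finRange 2).flatMap fun i => if q i = true then [.hadamard (i, .bit)] else []

/-- The description of `answerCircuit`. -/
def answerLetters (q : Fin 2 → Bool) : List Letter :=
  hadamardBit true ++ [.cnot, .first, .bit, .sep, .second, .bit, .sep] ++ hadamardBit true ++
    ((if q 0 = true then hadamardBit false else []) ++
      (if q 1 = true then hadamardBit true else []))

theorem flatMap_describe_answerCircuit (l w m a : ℕ) (q : Fin 2 → Bool) :
    (answerCircuit (l := l) (w := w) (m := m) (a := a) q).flatMap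
      (fun g => g.describe describeTwo) = answerLetters q := by
  cases h0 : q 0 <;> cases h1 : q 1 <;>
    simp [answerCircuit, answerLetters, List.finRange_succ, h0, h1, hadamardBit, Gate.describe,
      describeTwo, Wire.describe, ordinal, unary]

/-! ### Uniformity of the circuit families on two copies -/

section Uniform

variable {l w m a : ℕ → ℕ} {C : ∀ n, Circuit (Wire (l n) (w n) (m n) (a n))}

/-- Even for a fixed list of gates the description contains the register sizes, which vary with `n`;
they are taken over from the header of the given family. -/
theorem uniform_tail (h : Uniform fun n => describeCircuit (l n) (w n) (m n) (a n)
    Wire.describe (C n)) (tail : List Letter)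
    (D : ∀ n, Circuit (Fin 2 × Wire (l n) (w n) (m n) (a n)))
    (hD : ∀ n, (D n).flatMap (fun g => g.describe describeTwo) = tail) :
    Uniform fun n => describeCircuit (l n) (w n) (m n) (a n) describeTwo (D n) :=
  h.sweep (tailSweeper tail) fun n => ⟨1, by omega, by
    unfold describeCircuit
    rw [hD]
    exact sweeps_tailSweeper tail _ _ _ _ _⟩

theorem uniform_prepCircuit (h : Uniform fun n => describeCircuit (l n) (w n) (m n) (a n)
    Wire.describe (C n)) :
    Uniform fun n => describeCircuit (l n) (w n) (m n) (a n) describeTwo (prepCircuit (C n)) :=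
  h.sweep doubleSweeper fun n => ⟨2, by omega, by
    have h0 := flatMap_describe_map_copy false (Gate.hadamard .bit :: C n)
    have h1 := flatMap_describe_map_copy true (Gate.hadamard .bit :: C n)
    simp only [Bool.false_eq_true, if_false, if_true] at h0 h1
    unfold describeCircuit
    rw [prepCircuit, List.flatMap_append, h0, h1]
    exact sweeps_doubleSweeper _ _ _ _ _⟩

theorem uniform_hadamardPreCircuit (h : Uniform fun n => describeCircuit (l n) (w n) (m n) (a n)
    Wire.describe (C n)) :
    Uniform fun n => describeCircuit (l n) (w n) (m n) (a n) describeTwo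
      (hadamardPreCircuit (l n) (w n) (m n) (a n)) :=
  h.sweep hadamardSweeper fun n => ⟨2 * w n + 2, by simp [describeCircuit, unary]; omega, by
    unfold describeCircuit
    rw [flatMap_describe_hadamardPreCircuit]
    exact sweeps_hadamardSweeper _ _ _ _ _⟩

end Uniform

/-! ### Linearity and unitarity of circuits -/

section Linear

variable {ι : Type} [DecidableEq ι]

theorem Gate.apply_add (g : Gate ι) (ψ φ : QState ι) :
    g.apply (ψ + φ) = g.apply ψ + g.apply φ := by
  funext s
  cases g <;> simp only [Gate.apply, Pi.add_apply]
  · ring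
  · split_ifs <;> ring
  · split_ifs <;> rfl

theorem Gate.apply_smul (g : Gate ι) (c : ℂ) (ψ : QState ι) :
    g.apply (c • ψ) = c • g.apply ψ := by
  funext s
  cases g <;> simp only [Gate.apply, Pi.smul_apply, smul_eq_mul]
  · ring
  · split_ifs <;> ring
  · split_ifs <;> rfl

theorem Circuit.run_add (C : Circuit ι) (ψ φ : QState ι) : C.run (ψ + φ) = C.run ψ + C.run φ := by
  induction C generalizing ψ φ with
  | nil => rfl
  | cons g C ih =>
    simp only [Circuit.run, List.foldl_cons] at ih ⊢
    rw [g.apply_add, ih]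

theorem Circuit.run_smul (C : Circuit ι) (c : ℂ) (ψ : QState ι) : C.run (c • ψ) = c • C.run ψ := by
  induction C generalizing ψ with
  | nil => rfl
  | cons g C ih =>
    simp only [Circuit.run, List.foldl_cons] at ih ⊢
    rw [g.apply_smul, ih]

theorem Circuit.run_sub (C : Circuit ι) (ψ φ : QState ι) : C.run (ψ - φ) = C.run ψ - C.run φ := by
  rw [sub_eq_add_neg, ← neg_one_smul ℂ φ, C.run_add, C.run_smul, neg_one_smul, ← sub_eq_add_neg]

theorem Circuit.run_zero (C : Circuit ι) : C.run 0 = 0 := by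
  have := C.run_smul 0 0
  rwa [zero_smul, zero_smul] at this

theorem Circuit.run_append (C D : Circuit ι) (ψ : QState ι) :
    Circuit.run (C ++ D) ψ = D.run (C.run ψ) := List.foldl_append ..

theorem Circuit.run_cons (g : Gate ι) (C : Circuit ι) (ψ : QState ι) :
    Circuit.run (g :: C) ψ = C.run (g.apply ψ) := rfl

/-- Flip one bit. -/
def flipBit (i : ι) : Equiv.Perm (ι → Bool) where
  toFun s := Function.update s i (!s i)
  invFun s := Function.update s i (!s i)
  left_inv s := by simp
  right_inv s := by simp

theorem flipBit_apply (i : ι) (s : ι → Bool) : flipBit i s = Function.update s i (!s i) := rfl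

/-- The permutation of basis states induced by a controlled-not gate. -/
def cnotPerm (i j : ι) (h : i ≠ j) : Equiv.Perm (ι → Bool) :=
  Function.Involutive.toPerm (fun s => if s i = true then flipBit j s else s) fun s => by
    by_cases hs : s i = true <;> simp [hs, flipBit_apply, Function.update_of_ne h]

variable [Fintype ι]

theorem mass_nonneg (ψ : QState ι) : 0 ≤ mass ψ := Finset.sum_nonneg fun _ _ => by positivity

theorem mass_smul (c : ℂ) (ψ : QState ι) : mass (c • ψ) = ‖c‖ ^ 2 * mass ψ := by
  simp [mass, mul_pow, Finset.mul_sum]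

theorem norm_add_sq_le (a b : ℂ) : ‖a + b‖ ^ 2 ≤ 2 * (‖a‖ ^ 2 + ‖b‖ ^ 2) := by
  have h1 := parallelogram_law_with_norm ℝ a b
  nlinarith [sq_nonneg ‖a - b‖]

theorem mass_add_le (ψ φ : QState ι) : mass (ψ + φ) ≤ 2 * (mass ψ + mass φ) := by
  unfold mass
  rw [← Finset.sum_add_distrib, Finset.mul_sum]
  exact Finset.sum_le_sum fun s _ => norm_add_sq_le _ _

/-- The gate mixes only `s` and its flip at `i`. On such a pair the claim is the parallelogram law,
and summing over all `s` counts each pair twice on both sides. -/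
theorem mass_hadamard (i : ι) (ψ : QState ι) : mass ((Gate.hadamard i).apply ψ) = mass ψ := by
  have key : ∀ s, ‖(Gate.hadamard i).apply ψ s‖ ^ 2 +
      ‖(Gate.hadamard i).apply ψ (flipBit i s)‖ ^ 2 = ‖ψ s‖ ^ 2 + ‖ψ (flipBit i s)‖ ^ 2 := by
    intro s
    have h2 : ‖(Real.sqrt 2 : ℂ)‖ ^ 2 = 2 := by
      rw [Complex.norm_real, Real.norm_eq_abs, sq_abs, Real.sq_sqrt (by norm_num)]
    have hp := parallelogram_law_with_norm ℝ (ψ (Function.update s i false))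
      (ψ (Function.update s i true))
    cases hs : s i
    · have e1 : Function.update s i false = s := by rw [← hs, Function.update_eq_self]
      simp only [Gate.apply, flipBit_apply, Function.update_self, Function.update_idem, hs,
        norm_div, div_pow, h2]
      simp only [e1, Bool.not_false, Bool.false_eq_true, if_false, if_true, one_mul, neg_one_mul,
        ← sub_eq_add_neg] at hp ⊢
      linarith
    · have e1 : Function.update s i true = s := by rw [← hs, Function.update_eq_self]
      simp only [Gate.apply, flipBit_apply, Function.update_self, Function.update_idem, hs,
        norm_div, div_pow, h2]
      simp only [e1, Bool.not_true, Bool.false_eq_true, if_false, if_true, one_mul, neg_one_mul,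
        ← sub_eq_add_neg] at hp ⊢
      linarith
  have h1 := Equiv.sum_comp (flipBit i) (fun s => ‖(Gate.hadamard i).apply ψ s‖ ^ 2)
  have h2 := Equiv.sum_comp (flipBit i) (fun s => ‖ψ s‖ ^ 2)
  have h3 := Finset.sum_congr (rfl : (Finset.univ : Finset (ι → Bool)) = _) fun s _ => key s
  rw [Finset.sum_add_distrib, Finset.sum_add_distrib, h1, h2] at h3
  unfold mass
  linarith

theorem Gate.mass_apply (g : Gate ι) (ψ : QState ι) : mass (g.apply ψ) = mass ψ := by
  cases g with
  | hadamard i => exact mass_hadamard i ψ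
  | phase i =>
    refine Finset.sum_congr rfl fun s _ => ?_
    simp only [Gate.apply]
    split_ifs
    · rw [norm_mul, mul_comm Complex.I, Complex.norm_exp_ofReal_mul_I, one_mul]
    · rfl
  | cnot i j h =>
    refine Eq.trans (Finset.sum_congr rfl fun s _ => ?_)
      (Equiv.sum_comp (cnotPerm i j h) fun s => ‖ψ s‖ ^ 2)
    have hc : cnotPerm i j h s = if s i = true then flipBit j s else s := rfl
    rw [hc]
    simp only [Gate.apply]
    split_ifs <;> rfl

theorem Circuit.mass_run (C : Circuit ι) (ψ : QState ι) : mass (C.run ψ) = mass ψ := by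
  induction C generalizing ψ with
  | nil => rfl
  | cons g C ih => rw [Circuit.run_cons, ih, g.mass_apply]

theorem mass_single (s : ι → Bool) : mass (Pi.single s 1 : QState ι) = 1 := by
  unfold mass
  rw [Finset.sum_eq_single s]
  · simp
  · intro t _ ht; simp [ht]
  · simp

end Linear

/-! ### Measurements -/

section Measure

variable {ι : Type} (p : (ι → Bool) → Prop)

theorem postMeasure_sub (ψ φ : QState ι) :
    postMeasure p (ψ - φ) = postMeasure p ψ - postMeasure p φ := by
  funext s; simp only [postMeasure, Pi.sub_apply]; split_ifs <;> simp

variable {p}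

theorem postMeasure_of_not {ψ : QState ι} {s : ι → Bool} (h : ¬ p s) : postMeasure p ψ s = 0 := by
  simp [postMeasure, h]

theorem postMeasure_of {ψ : QState ι} {s : ι → Bool} (h : p s) : postMeasure p ψ s = ψ s := by
  simp [postMeasure, h]

theorem sum_mass_postMeasure [Fintype ι] [DecidableEq ι] {α : Type} [Fintype α]
    (f : (ι → Bool) → α) (ψ : QState ι) :
    ∑ o, mass (postMeasure (fun s => f s = o) ψ) = mass ψ := by
  classical
  unfold mass
  rw [Finset.sum_comm]
  refine Finset.sum_congr rfl fun s _ => ?_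
  rw [Finset.sum_eq_single (f s)]
  · rw [postMeasure_of (p := fun s' => f s' = f s) rfl]
  · intro o _ ho
    rw [postMeasure_of_not (p := fun s' => f s' = o) (Ne.symm ho)]; simp
  · simp

open Classical in
/-- If a state is close to one for which all outcomes are good, then its outcomes are good with
probability close to one. -/
theorem abs_sum_mass_sub_le {ι' Ω : Type} [Fintype ι] [DecidableEq ι] [Fintype ι']
    [DecidableEq ι'] [Fintype Ω] (K : Ω → QState ι → QState ι')
    (hsub : ∀ o ψ φ, K o (ψ - φ) = K o ψ - K o φ) (htot : ∀ ψ, ∑ o, mass (K o ψ) = mass ψ)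
    (good : Ω → Prop) (ψ φ : QState ι) (hφ : ∀ o, ¬ good o → K o φ = 0) :
    |(∑ o, if good o then mass (K o ψ) else 0) - mass ψ| ≤ mass (ψ - φ) := by
  have h1 : mass ψ - (∑ o, if good o then mass (K o ψ) else 0) =
      ∑ o, if good o then 0 else mass (K o ψ) := by
    rw [← htot, ← Finset.sum_sub_distrib]
    refine Finset.sum_congr rfl fun o _ => ?_
    split_ifs <;> simp
  rw [abs_sub_comm, h1, abs_of_nonneg]
  · rw [← htot]
    refine Finset.sum_le_sum fun o _ => ?_
    split_ifs with h
    · exact mass_nonneg _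
    -- On a bad outcome the reference state contributes nothing, so `K o ψ` equals `K o (ψ - φ)` and
    -- no constant is lost.
    · rw [hsub, hφ o h, sub_zero]
  · refine Finset.sum_nonneg fun o _ => ?_
    split_ifs
    · exact le_rfl
    · exact mass_nonneg _

end Measure

/-! ### Symmetries of states -/

/-- The sign `(-1) ^ b`. -/
def sign (b : Bool) : ℂ := if b then -1 else 1

@[simp] theorem sign_false : sign false = 1 := rfl

@[simp] theorem sign_true : sign true = -1 := rfl

theorem sign_xor (a b : Bool) : sign (xor a b) = sign a * sign b := by
  cases a <;> cases b <;> simp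

theorem eq_of_sign_mul_eq_one {a b : Bool} (h : sign a * sign b = 1) : a = b := by
  cases a <;> cases b <;> simp at h ⊢ <;> norm_num at h

theorem prod_sign_eq_dotBit {n : ℕ} (d x : BitString n) :
    ∏ j, sign (x j && d j) = sign (dotBit d x) := by
  have h : ∀ j, sign (x j && d j) = if d j = true ∧ x j = true then -1 else 1 := by
    intro j; cases d j <;> cases x j <;> simp
  simp only [h, Finset.prod_ite, Finset.prod_const, one_pow, mul_one]
  rcases Nat.even_or_odd (Finset.univ.filter fun j => d j = true ∧ x j = true).card with hc | hc
  · rw [hc.neg_one_pow, dotBit, decide_eq_false (Nat.not_odd_iff_even.2 hc)]; rfl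
  · rw [hc.neg_one_pow, dotBit, decide_eq_true hc]; rfl

section Symmetry

variable {ι : Type} [DecidableEq ι]

/-- Flip the bits in a mask. -/
def flipMask (m s : ι → Bool) : ι → Bool := fun i => xor (s i) (m i)

/-- Flipping the bits in `m` multiplies the amplitudes by `g`. -/
def Symmetric (m : ι → Bool) (g : (ι → Bool) → ℂ) (ψ : QState ι) : Prop :=
  ∀ s, ψ (flipMask m s) = g s * ψ s

/-- Conjugation by a Hadamard gate turns `X` into `Z`: wire `i` leaves the mask and, if it was in
it, contributes the sign `(-1)^(s i)`. The old factor passes through unchanged as it does not depend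
on wire `i`. -/
theorem Symmetric.hadamard {m : ι → Bool} {g : (ι → Bool) → ℂ} {ψ : QState ι} {i : ι}
    (h : Symmetric m g ψ) (hg : ∀ s b, g (Function.update s i b) = g s) :
    Symmetric (Function.update m i false) (fun s => g s * sign (m i && s i))
      ((Gate.hadamard i).apply ψ) := by
  intro s
  have hi : flipMask (Function.update m i false) s i = s i := by simp [flipMask]
  have hu : ∀ b, Function.update (flipMask (Function.update m i false) s) i b =
      flipMask m (Function.update s i (xor b (m i))) := by
    intro b
    funext j
    by_cases hj : j = i
    · subst hj; simp [flipMask]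
    · simp [flipMask, hj]
  simp only [Gate.apply, hi, hu, h _, hg]
  cases m i <;> cases s i <;> simp <;> ring

theorem Symmetric.hadamards (l : List ι) (hl : l.Nodup) {m m' : ι → Bool}
    {g : (ι → Bool) → ℂ} {ψ : QState ι} (h : Symmetric m g ψ)
    (hg : ∀ i ∈ l, ∀ s b, g (Function.update s i b) = g s) (hm : ∀ i ∈ l, m' i = false)
    (hm' : ∀ i, i ∉ l → m' i = m i) :
    Symmetric m' (fun s => g s * (l.map fun i => sign (m i && s i)).prod)
      (Circuit.run (l.map Gate.hadamard) ψ) := by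
  induction l generalizing m g ψ with
  | nil =>
    obtain rfl : m' = m := funext fun i => hm' i List.not_mem_nil
    intro s
    simpa [Circuit.run] using h s
  | cons i l ih =>
    obtain ⟨hi, hl⟩ := List.nodup_cons.1 hl
    have h1 := ih hl (h.hadamard (hg i List.mem_cons_self)) (by
      intro j hj s b
      rw [hg j (List.mem_cons_of_mem _ hj),
        Function.update_of_ne (ne_of_mem_of_not_mem hj hi).symm])
      (fun j hj => hm j (List.mem_cons_of_mem _ hj)) (fun j hj => by
        by_cases hji : j = i
        · subst hji; simpa using hm j List.mem_cons_self
        · rw [Function.update_of_ne hji, hm' j (by simp [hji, hj])])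
    intro s
    have h2 := h1 s
    beta_reduce at h2
    have hp : (l.map fun j => sign (Function.update m i false j && s j)) =
        l.map fun j => sign (m j && s j) := by
      refine List.map_congr_left fun j hj => ?_
      rw [Function.update_of_ne (ne_of_mem_of_not_mem hj hi)]
    rw [hp] at h2
    rw [List.map_cons, Circuit.run_cons, h2]
    simp only [List.map_cons, List.prod_cons, mul_assoc]

/-- A Hadamard gate combines only amplitudes that differ at its own wire, so vanishing on a set
insensitive to these wires persists. -/
theorem hadamards_eq_zero (l : List ι) {P : (ι → Bool) → Prop}
    (hP : ∀ i ∈ l, ∀ s b, P s → P (Function.update s i b)) {ψ : QState ι}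
    (h : ∀ s, P s → ψ s = 0) : ∀ s, P s → Circuit.run (l.map Gate.hadamard) ψ s = 0 := by
  induction l generalizing ψ with
  | nil => exact h
  | cons i l ih =>
    refine ih (fun j hj => hP j (List.mem_cons_of_mem _ hj)) fun s hs => ?_
    have hi := hP i List.mem_cons_self s
    simp [Gate.apply, h _ (hi _ hs)]

theorem hadamard_comm (i j : ι) (ψ : QState ι) :
    (Gate.hadamard j).apply ((Gate.hadamard i).apply ψ) =
      (Gate.hadamard i).apply ((Gate.hadamard j).apply ψ) := by
  by_cases h : i = j
  · rw [h]
  · funext s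
    simp only [Gate.apply, Function.update_of_ne h, Function.update_of_ne (Ne.symm h),
      Function.update_comm h]
    ring

/-- Needed because the transducer prints the gates in descending order and alternates between the
copies, unlike `hadamardAll`. -/
theorem run_hadamards_perm {l l' : List ι} (h : l.Perm l') (ψ : QState ι) :
    Circuit.run (l.map Gate.hadamard) ψ = Circuit.run (l'.map Gate.hadamard) ψ := by
  induction h generalizing ψ with
  | nil => rfl
  | cons i _ ih => exact ih _
  | swap i j l => simp only [List.map_cons, Circuit.run_cons, hadamard_comm i j]
  | trans _ _ ih₁ ih₂ => exact (ih₁ ψ).trans (ih₂ ψ)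

end Symmetry

/-! ### Product states -/

/-- The tensor product of states of the two copies of some qubits. -/
def tensor {ι : Type} (ψ φ : QState ι) : QState (Fin 2 × ι) :=
  fun s => ψ (fun v => s (0, v)) * φ (fun v => s (1, v))

section Tensor

variable {ι : Type} [DecidableEq ι]

theorem update_copy (i : Fin 2) (v : ι) (s : Fin 2 × ι → Bool) (b : Bool) :
    (fun u => Function.update s (i, v) b (i, u)) = Function.update (fun u => s (i, u)) v b := by
  funext u
  by_cases h : u = v
  · subst h; simp
  · simp [h]

theorem update_copy_of_ne {i j : Fin 2} (h : j ≠ i) (v : ι) (s : Fin 2 × ι → Bool) (b : Bool) :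
    (fun u => Function.update s (i, v) b (j, u)) = fun u => s (j, u) := by
  funext u
  simp [h]

theorem copy_zero_apply_tensor (g : Gate ι) (ψ φ : QState ι) :
    (g.copy 0).apply (tensor ψ φ) = tensor (g.apply ψ) φ := by
  funext s
  cases g <;> simp only [Gate.copy, Gate.apply, tensor, update_copy,
    update_copy_of_ne (show (1 : Fin 2) ≠ 0 by decide)]
  · ring
  · split_ifs <;> ring
  · split_ifs <;> rfl

theorem copy_one_apply_tensor (g : Gate ι) (ψ φ : QState ι) :
    (g.copy 1).apply (tensor ψ φ) = tensor ψ (g.apply φ) := by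
  funext s
  cases g <;> simp only [Gate.copy, Gate.apply, tensor, update_copy,
    update_copy_of_ne (show (0 : Fin 2) ≠ 1 by decide)]
  · ring
  · split_ifs <;> ring
  · split_ifs <;> rfl

theorem run_map_copy_zero (C : Circuit ι) (ψ φ : QState ι) :
    Circuit.run (C.map (Gate.copy 0)) (tensor ψ φ) = tensor (C.run ψ) φ := by
  induction C generalizing ψ with
  | nil => rfl
  | cons g C ih => rw [List.map_cons, Circuit.run_cons, copy_zero_apply_tensor, ih]; rfl

theorem run_map_copy_one (C : Circuit ι) (ψ φ : QState ι) :
    Circuit.run (C.map (Gate.copy 1)) (tensor ψ φ) = tensor ψ (C.run φ) := by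
  induction C generalizing φ with
  | nil => rfl
  | cons g C ih => rw [List.map_cons, Circuit.run_cons, copy_one_apply_tensor, ih]; rfl

/-- A basis state of two copies as a pair of basis states. -/
def copiesEquiv (ι : Type) : (Fin 2 × ι → Bool) ≃ (ι → Bool) × (ι → Bool) where
  toFun s := (fun v => s (0, v), fun v => s (1, v))
  invFun p v := if v.1 = 0 then p.1 v.2 else p.2 v.2
  left_inv s := by
    funext ⟨i, v⟩
    fin_cases i <;> simp
  right_inv p := by simp

theorem mass_tensor [Fintype ι] (ψ φ : QState ι) : mass (tensor ψ φ) = mass ψ * mass φ := by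
  unfold mass
  rw [Finset.sum_mul_sum, ← Fintype.sum_prod_type',
    ← (copiesEquiv ι).sum_comp fun p => ‖ψ p.1‖ ^ 2 * ‖φ p.2‖ ^ 2]
  refine Finset.sum_congr rfl fun s _ => ?_
  rw [tensor, norm_mul, mul_pow]; rfl

/-- One factor is replaced at a time; the factor left alone has mass one. The constant is `2 * (δ +
δ)`. -/
theorem mass_tensor_sub_le [Fintype ι] {ψ₀ ψ₁ φ₀ φ₁ : QState ι} {δ : ℝ} (h₀ : mass φ₀ = 1)
    (h₁ : mass ψ₁ = 1) (hd₀ : mass (ψ₀ - φ₀) ≤ δ) (hd₁ : mass (ψ₁ - φ₁) ≤ δ) :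
    mass (tensor ψ₀ ψ₁ - tensor φ₀ φ₁) ≤ 4 * δ := by
  have h : tensor ψ₀ ψ₁ - tensor φ₀ φ₁ = tensor (ψ₀ - φ₀) ψ₁ + tensor φ₀ (ψ₁ - φ₁) := by
    funext s
    simp only [tensor, Pi.sub_apply, Pi.add_apply]
    ring
  rw [h]
  refine (mass_add_le _ _).trans ?_
  rw [mass_tensor, mass_tensor, h₀, h₁]
  linarith

end Tensor

/-! ### Negligible functions and averages -/

theorem Negligible.add {ε δ : ℕ → ℝ} (hε : Negligible ε) (hδ : Negligible δ) :
    Negligible fun n => ε n + δ n :=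
  ⟨fun n => add_nonneg (hε.1 n) (hδ.1 n), fun p => by
    simpa [add_mul] using (hε.2 p).add (hδ.2 p)⟩

theorem Negligible.const_mul {ε : ℕ → ℝ} (hε : Negligible ε) {c : ℝ} (hc : 0 ≤ c) :
    Negligible fun n => c * ε n :=
  ⟨fun n => mul_nonneg hc (hε.1 n), fun p => by
    simpa [mul_assoc] using (hε.2 p).const_mul c⟩

theorem abs_average_sub_one_le {Ω : Type*} [Fintype Ω] {w A : Ω → ℝ} {ε : ℝ} (hw : ∀ o, 0 ≤ w o)
    (hsum : ∑ o, w o = 1) (hA : ∀ o, w o ≠ 0 → |A o - 1| ≤ ε) : |∑ o, w o * A o - 1| ≤ ε := by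
  have h1 : ∑ o, w o * A o - 1 = ∑ o, w o * (A o - 1) := by
    simp only [mul_sub, mul_one, Finset.sum_sub_distrib, hsum]
  rw [h1]
  calc |∑ o, w o * (A o - 1)| ≤ ∑ o, |w o * (A o - 1)| := Finset.abs_sum_le_sum_abs _ _
    _ ≤ ∑ o, w o * ε := by
      refine Finset.sum_le_sum fun o _ => ?_
      rw [abs_mul, abs_of_nonneg (hw o)]
      by_cases h : w o = 0
      · simp [h]
      · exact mul_le_mul_of_nonneg_left (hA o h) (hw o)
    _ = ε := by rw [← Finset.sum_mul, hsum, one_mul]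

theorem PMF.sum_toReal {α : Type*} [Fintype α] (p : PMF α) : ∑ a, (p a).toReal = 1 := by
  rw [← ENNReal.toReal_sum fun a _ => p.apply_ne_top a, ← tsum_fintype (L := .unconditional _),
    p.tsum_coe, ENNReal.toReal_one]

/-! ### The states of one copy of the registers -/

section Wires

variable {l w m a : ℕ}

/-- Basis states as tuples of register contents. -/
def wireEquiv (l w m a : ℕ) : (Wire l w m a → Bool) ≃
    (BitString l × Bool × BitString a) × (BitString w × BitString m) where
  toFun s := ((fun j => s (.key j), s .bit, fun j => s (.work j)),
    (fun j => s (.pre j), fun j => s (.img j)))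
  invFun p v := match v with
    | .key j => p.1.1 j
    | .bit => p.1.2.1
    | .pre j => p.2.1 j
    | .img j => p.2.2 j
    | .work j => p.1.2.2 j
  left_inv s := by funext v; cases v <;> rfl
  right_inv _ := rfl

-- In the coordinates of `wireEquiv` the condition fixes key, bit and work qubits, so only the
-- contents of `pre` and `img` remain. This reduces masses of sampling states to sums of
-- probabilities.
open Classical in
theorem sum_wire (X : Finset (BitString w)) (k : BitString l) (b : Bool)
    (F : BitString w → BitString m → ℝ) :
    (∑ s : Wire l w m a → Bool, if (fun j => s (.key j)) = k ∧ s .bit = b ∧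
      (fun j => s (.pre j)) ∈ X ∧ (∀ j, s (.work j) = false) then
        F (fun j => s (.pre j)) (fun j => s (.img j)) else 0) = ∑ x ∈ X, ∑ y, F x y := by
  rw [← (wireEquiv l w m a).symm.sum_comp, Fintype.sum_prod_type,
    Finset.sum_eq_single (k, b, fun _ => false)]
  · rw [Fintype.sum_prod_type]
    simp only [wireEquiv, Equiv.coe_fn_symm_mk, true_and, implies_true, and_true]
    rw [← Finset.sum_filter_add_sum_filter_not Finset.univ (· ∈ X), Finset.filter_mem_eq_inter,
      Finset.univ_inter, add_eq_left.2]
    · refine Finset.sum_congr rfl fun x hx => ?_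
      simp [hx]
    · refine Finset.sum_eq_zero fun x hx => ?_
      simp [(Finset.mem_filter.1 hx).2]
  · rintro ⟨k', b', a'⟩ _ h
    refine Finset.sum_eq_zero fun p _ => if_neg ?_
    rintro ⟨hk, hb, _, ha⟩
    exact h (Prod.ext hk (Prod.ext hb (funext ha)))
  · simp

theorem sqrt_div_sq {p c : ℝ} (hp : 0 ≤ p) (hc : 0 ≤ c) :
    (Real.sqrt p / Real.sqrt c) ^ 2 = p / c := by
  rw [div_pow, Real.sq_sqrt hp, Real.sq_sqrt hc]

variable {X : Finset (BitString w)} (hX : X.Nonempty)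

include hX in
theorem mass_sampOutput (p : BitString w → PMF (BitString m)) (k : BitString l) (b : Bool) :
    mass (sampOutput X p k b : QState (Wire l w m a)) = 1 := by
  classical
  have hc : (X.card : ℝ) ≠ 0 := by exact_mod_cast hX.card_pos.ne'
  have h := sum_wire (l := l) (a := a) X k b fun x y => (p x y).toReal / X.card
  have h1 : ∀ x ∈ X, ∑ y, (p x y).toReal / X.card = 1 / X.card := fun x _ => by
    rw [← Finset.sum_div, PMF.sum_toReal]
  rw [Finset.sum_congr rfl h1, Finset.sum_const, nsmul_eq_mul, mul_one_div_cancel hc] at h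
  rw [← h]
  refine Finset.sum_congr rfl fun s _ => ?_
  unfold sampOutput
  split_ifs with hs
  · rw [Complex.norm_real, Real.norm_eq_abs, sq_abs,
      sqrt_div_sq ENNReal.toReal_nonneg (Nat.cast_nonneg _)]
  · simp

theorem sum_sqrt_sub_sq {α : Type} [Fintype α] (p q : PMF α) :
    ∑ y, (Real.sqrt (p y).toReal - Real.sqrt (q y).toReal) ^ 2 = 2 * hellingerSq p q := by
  have h : ∀ y, (Real.sqrt (p y).toReal - Real.sqrt (q y).toReal) ^ 2 =
      (p y).toReal + (q y).toReal - 2 * Real.sqrt ((p y).toReal * (q y).toReal) := by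
    intro y
    rw [sub_sq, Real.sq_sqrt ENNReal.toReal_nonneg, Real.sq_sqrt ENNReal.toReal_nonneg,
      Real.sqrt_mul ENNReal.toReal_nonneg]
    ring
  simp only [h, Finset.sum_sub_distrib, Finset.sum_add_distrib, PMF.sum_toReal,
    ← Finset.mul_sum, hellingerSq]
  ring

/-- Amplitudes are square roots of probabilities, so their squared distance is a Hellinger distance.
This is what allows `f` to replace `f'` in the prepared state. -/
theorem mass_sampOutput_sub (p q : BitString w → PMF (BitString m)) (k : BitString l) (b : Bool) :
    mass (sampOutput X q k b - sampOutput X p k b : QState (Wire l w m a)) =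
      2 * ((∑ x ∈ X, hellingerSq (p x) (q x)) / X.card) := by
  classical
  have h := sum_wire (l := l) (a := a) X k b fun x y =>
    (Real.sqrt (p x y).toReal - Real.sqrt (q x y).toReal) ^ 2 / X.card
  simp only [← Finset.sum_div, sum_sqrt_sub_sq, ← Finset.mul_sum] at h
  rw [← mul_div_assoc, ← h]
  refine Finset.sum_congr rfl fun s _ => ?_
  simp only [Pi.sub_apply]
  unfold sampOutput
  split_ifs with hs
  · rw [← Complex.ofReal_sub, Complex.norm_real, Real.norm_eq_abs, sq_abs, ← sub_div, div_pow,
      Real.sq_sqrt (Nat.cast_nonneg _), sub_sq_comm]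
  · simp

open Classical in
/-- The state `|k⟩ (2 |X|)^{-1/2} ∑_{b, x ∈ X, y} √(p b x y) |b⟩ |x⟩ |y⟩ |0⟩`. -/
def copyState (X : Finset (BitString w)) (p : Bool → BitString w → PMF (BitString m))
    (k : BitString l) : QState (Wire l w m a) := fun s =>
  if (fun j => s (.key j)) = k ∧ (fun j => s (.pre j)) ∈ X ∧ ∀ j, s (.work j) = false then
    ((Real.sqrt (p (s .bit) (fun j => s (.pre j)) (fun j => s (.img j))).toReal /
      Real.sqrt (2 * X.card) : ℝ) : ℂ)
  else 0

theorem copyState_eq (p : Bool → BitString w → PMF (BitString m)) (k : BitString l) :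
    (copyState X p k : QState (Wire l w m a)) =
      (1 / Real.sqrt 2 : ℂ) • (sampOutput X (p false) k false + sampOutput X (p true) k true) := by
  funext s
  simp only [copyState, sampOutput, Pi.smul_apply, Pi.add_apply, smul_eq_mul]
  have h2 : Real.sqrt (2 * X.card) = Real.sqrt 2 * Real.sqrt X.card :=
    Real.sqrt_mul (by norm_num) _
  cases hb : s .bit <;> simp only [Bool.false_eq_true, Bool.true_eq_false, false_and, and_false,
    true_and, if_false, add_zero, zero_add, h2] <;> split_ifs <;> push_cast <;> ring

theorem norm_one_div_sqrt_two_sq : ‖(1 / Real.sqrt 2 : ℂ)‖ ^ 2 = 1 / 2 := by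
  rw [norm_div, norm_one, Complex.norm_real, Real.norm_eq_abs, div_pow, sq_abs,
    Real.sq_sqrt (by norm_num), one_pow]

include hX in
theorem mass_copyState (p : Bool → BitString w → PMF (BitString m)) (k : BitString l) :
    mass (copyState X p k : QState (Wire l w m a)) = 1 := by
  have h : mass (sampOutput X (p false) k false + sampOutput X (p true) k true :
      QState (Wire l w m a)) = mass (sampOutput X (p false) k false : QState (Wire l w m a)) +
        mass (sampOutput X (p true) k true : QState (Wire l w m a)) := by
    unfold mass
    rw [← Finset.sum_add_distrib]
    refine Finset.sum_congr rfl fun s _ => ?_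
    -- The two states have disjoint supports since they differ in `bit`, so there is no cross term.
    cases hb : s .bit <;> simp [sampOutput, hb]
  rw [copyState_eq, mass_smul, h, mass_sampOutput hX, mass_sampOutput hX,
    norm_one_div_sqrt_two_sq]
  norm_num

theorem hadamard_apply_sampInput (k : BitString l) :
    (Gate.hadamard .bit).apply (sampInput k false : QState (Wire l w m a)) =
      (1 / Real.sqrt 2 : ℂ) • (sampInput k false + sampInput k true) := by
  funext s
  have key : ∀ b, (sampInput k false : QState (Wire l w m a)) (Function.update s .bit b) =
      if b = false then sampInput k (s .bit) s else 0 := by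
    intro b
    unfold sampInput
    simp only [Pi.single_apply]
    cases b
    · rw [if_pos rfl]
      refine if_congr ⟨fun h => ?_, fun h => ?_⟩ rfl rfl
      · funext v
        have := congrFun h v
        cases v <;> simp_all
      · rw [h]
        funext v
        cases v <;> simp
    · refine if_neg fun h => ?_
      simpa using congrFun h .bit
  have key' : ∀ b, s .bit ≠ b → (sampInput k b : QState (Wire l w m a)) s = 0 := by
    intro b hb
    unfold sampInput
    rw [Pi.single_apply]
    exact if_neg fun h => hb (by rw [h])
  simp only [Gate.apply, key, Pi.smul_apply, Pi.add_apply, smul_eq_mul]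
  cases hb : s .bit
  · rw [key' true (by simp [hb])]; simp; ring
  · rw [key' false (by simp [hb])]; simp; ring

/-- By linearity the error is the sum of the two branch errors divided by `√2`; `mass_add_le` and
the factor `1 / 2` leave `δ + δ`. -/
theorem mass_run_sub_copyState_le (C : Circuit (Wire l w m a))
    (p : Bool → BitString w → PMF (BitString m)) (k : BitString l) {δ : ℝ}
    (h : ∀ b, mass (C.run (sampInput k b) - sampOutput X (p b) k b) ≤ δ) :
    mass (Circuit.run (.hadamard .bit :: C) (sampInput k false) - copyState X p k) ≤ 2 * δ := by
  have e : Circuit.run (.hadamard .bit :: C) (sampInput k false) - copyState X p k =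
      (1 / Real.sqrt 2 : ℂ) • ((C.run (sampInput k false) - sampOutput X (p false) k false) +
        (C.run (sampInput k true) - sampOutput X (p true) k true)) := by
    rw [Circuit.run_cons, hadamard_apply_sampInput, C.run_smul, C.run_add, copyState_eq,
      ← smul_sub, add_sub_add_comm]
  rw [e, mass_smul, norm_one_div_sqrt_two_sq]
  have := mass_add_le (C.run (sampInput k false) - sampOutput X (p false) k false)
    (C.run (sampInput k true) - sampOutput X (p true) k true)
  linarith [h false, h true]

theorem run_prepCircuit (C : Circuit (Wire l w m a)) (ψ φ : QState (Wire l w m a)) :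
    (prepCircuit C).run (tensor ψ φ) =
      tensor (Circuit.run (.hadamard .bit :: C) ψ) (Circuit.run (.hadamard .bit :: C) φ) := by
  rw [prepCircuit, Circuit.run_append, run_map_copy_zero, run_map_copy_one]

end Wires

/-! ### The honest prover -/

/-- The honest prover. -/
def honestProver (E : ENTCFCore) : Prover E where
  work := E.sampWork
  prep n := prepCircuit (E.samp n)
  preimage _ := []
  hadamard n := hadamardPreCircuit (E.keyLen n) (E.preLen n) (E.imgLen n) (E.sampWork n)
  answer q _ := answerCircuit q

theorem honestProver_isEfficient (E : ENTCFCore) : (honestProver E).IsEfficient :=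
  ⟨uniform_prepCircuit E.samp_uniform, uniform_tail E.samp_uniform [] _ (fun _ => rfl),
    uniform_hadamardPreCircuit E.samp_uniform, fun q =>
    uniform_tail E.samp_uniform (answerLetters q) _
      (fun _ => flatMap_describe_answerCircuit _ _ _ _ q)⟩

namespace Prover

variable {E : ENTCFCore} (P : Prover E) (n : ℕ)

theorem input_eq (k : Fin 2 → E.Key n) :
    P.input n k = tensor (sampInput (k 0) false) (sampInput (k 1) false) := by
  funext s
  simp only [input, tensor, sampInput, Pi.single_apply, ← ite_and, mul_ite, mul_one, mul_zero]
  refine if_congr ⟨fun h => ⟨?_, ?_⟩, fun h => ?_⟩ rfl rfl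
  · funext v; rw [h]; cases v <;> rfl
  · funext v; rw [h]; cases v <;> rfl
  · funext ⟨i, v⟩
    fin_cases i
    · have := congrFun h.2 v; cases v <;> exact this
    · have := congrFun h.1 v; cases v <;> exact this

theorem mass_input (k : Fin 2 → E.Key n) : mass (P.input n k) = 1 := mass_single _

theorem honestState_eq (θ : Fin 2 → Bool) (k : Fin 2 → E.Key n) :
    P.honestState n θ k = tensor (copyState (E.dom n) (E.fn n (θ 0) (k 0)) (k 0))
      (copyState (E.dom n) (E.fn n (θ 1) (k 1)) (k 1)) := by
  funext s
  rw [honestState, Fin.prod_univ_two]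
  rfl

/-- The qubits of both registers `pre`. -/
def preWires : List (P.Qubit n) :=
  (List.finRange 2).flatMap fun i => (List.finRange (E.preLen n)).map fun j => (i, .pre j)

theorem hadamardAll_eq : P.hadamardAll n = (P.preWires n).map Gate.hadamard := by
  simp [hadamardAll, preWires, List.map_flatMap, Function.comp_def]

theorem mem_preWires {v : P.Qubit n} : v ∈ P.preWires n ↔ ∃ j, v.2 = .pre j := by
  obtain ⟨i, v⟩ := v
  simp [preWires, eq_comm]

theorem nodup_preWires : (P.preWires n).Nodup := by
  rw [preWires, List.nodup_flatMap]
  refine ⟨fun i _ => (List.nodup_finRange _).map fun j j' h => ?_, ?_⟩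
  · simpa using h
  · refine (List.nodup_finRange 2).imp fun {i i'} h => ?_
    simp only [Function.onFun, List.disjoint_left, List.mem_map]
    rintro _ ⟨j, _, rfl⟩ ⟨j', _, h'⟩
    exact h (congrArg Prod.fst h').symm

theorem run_hadamardPreCircuit (ψ : QState (P.Qubit n)) :
    (hadamardPreCircuit (E.keyLen n) (E.preLen n) (E.imgLen n) (P.work n)).run ψ =
      (P.hadamardAll n).run ψ := by
  have h : hadamardPreCircuit (E.keyLen n) (E.preLen n) (E.imgLen n) (P.work n) =
      ((List.finRange (E.preLen n)).reverse.flatMap fun j =>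
        [((0, .pre j) : P.Qubit n), (1, .pre j)]).map Gate.hadamard := by
    simp [hadamardPreCircuit, List.map_flatMap]
  rw [h, hadamardAll_eq]
  refine run_hadamards_perm ((List.perm_ext_iff_of_nodup ?_ (P.nodup_preWires n)).2 fun v => ?_) ψ
  · rw [List.nodup_flatMap]
    refine ⟨fun j _ => by simp, ?_⟩
    refine (List.nodup_reverse.2 (List.nodup_finRange _)).imp fun {j j'} h => ?_
    simpa [Function.onFun] using Ne.symm h
  · obtain ⟨i, v⟩ := v
    rw [mem_preWires]
    fin_cases i <;> simp

/-- Since `H X H = Z`, a controlled-not gate between two Hadamard gates on its target is a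
controlled-`Z` gate. -/
theorem run_answerCircuit (q : Fin 2 → Bool) (ψ : QState (P.Qubit n)) :
    Circuit.run (answerCircuit q) ψ = (P.basisChange n q).run (P.controlledZ n ψ) := by
  rw [answerCircuit, Circuit.run_append]
  refine congrArg _ ?_
  have h2 : (Real.sqrt 2 : ℂ) * (Real.sqrt 2 : ℂ) = 2 := by
    rw [← Complex.ofReal_mul, Real.mul_self_sqrt (by norm_num)]; norm_num
  have h2' : (Real.sqrt 2 : ℂ) ≠ 0 := by
    intro h; rw [h] at h2; norm_num at h2
  funext s
  have h01 : ((0, .bit) : P.Qubit n) ≠ (1, .bit) := by simp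
  simp only [Circuit.run, List.foldl_cons, List.foldl_nil, Gate.apply, controlledZ,
    Function.update_of_ne h01, Function.update_self, Function.update_idem, Bool.not_false,
    Bool.not_true]
  have e := Function.update_eq_self ((1, .bit) : P.Qubit n) s
  cases hi : s (0, .bit) <;> cases hj : s (1, .bit) <;> rw [hj] at e <;>
    simp [e] <;> field_simp <;> rw [sq, h2] <;> ring

end Prover

theorem exists_mass_prep_sub_le (E : ENTCFCore) : ∃ ε, Negligible ε ∧
    ∀ (n : ℕ) (θ : Fin 2 → Bool) (kt : Fin 2 → E.Key n × E.Trapdoor n),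
      (∀ i, kt i ∈ (E.gen n (θ i)).support) →
        mass (((honestProver E).prep n).run ((honestProver E).input n fun i => (kt i).1) -
          (honestProver E).honestState n θ (fun i => (kt i).1)) ≤ ε n := by
  obtain ⟨εs, hεs, hs⟩ := E.samp_spec
  obtain ⟨εh, hεh, hh⟩ := E.hellinger_le
  -- For each value of `bit` the error is at most `2 * (εs + 2 * εh)`, by passing through `f'` for
  -- claw-free keys. Superposing both values doubles this, and the tensor product multiplies it by
  -- 4.
  refine ⟨fun n => 16 * εs n + 32 * εh n,
    (hεs.const_mul (by norm_num)).add (hεh.const_mul (by norm_num)), fun n θ kt hkt => ?_⟩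
  have hb : ∀ i b, mass ((E.samp n).run (sampInput (kt i).1 b) -
      sampOutput (E.dom n) (E.fn n (θ i) (kt i).1 b) (kt i).1 b) ≤ 2 * (εs n + 2 * εh n) := by
    intro i b
    have hk := hkt i
    cases hθ : θ i
    · rw [ENTCFCore.gen, hθ, if_neg (by simp)] at hk
      have h1 := (hs n b).2 _ hk
      rw [ENTCFCore.fn, if_neg (by simp)]
      linarith [hεs.1 n, hεh.1 n]
    · rw [ENTCFCore.gen, hθ, if_pos rfl] at hk
      have h1 := (hs n b).1 _ hk
      have h2 := hh n _ hk b
      rw [ENTCFCore.fn, if_pos rfl, ← sub_add_sub_cancel _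
        (sampOutput (E.dom n) (E.f' n (kt i).1 b) (kt i).1 b)]
      refine (mass_add_le _ _).trans ?_
      rw [mass_sampOutput_sub]
      linarith
  have hd := fun i => mass_run_sub_copyState_le (E.samp n) (E.fn n (θ i) (kt i).1) (kt i).1
    (hb i)
  have h1 : mass (Circuit.run (.hadamard .bit :: E.samp n) (sampInput (kt 1).1 false)) = 1 := by
    rw [Circuit.mass_run]; exact mass_single _
  have key := mass_tensor_sub_le
    (mass_copyState (E.dom_nonempty n) (E.fn n (θ 0) (kt 0).1) (kt 0).1) h1 (hd 0) (hd 1)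
  have hrun : ((honestProver E).prep n).run ((honestProver E).input n fun i => (kt i).1) =
      tensor (Circuit.run (.hadamard .bit :: E.samp n) (sampInput (kt 0).1 false))
        (Circuit.run (.hadamard .bit :: E.samp n) (sampInput (kt 1).1 false)) := by
    rw [Prover.input_eq]
    exact run_prepCircuit _ _ _
  rw [hrun, Prover.honestState_eq]
  exact key.trans (by linarith)

theorem honestProver_isHonest (E : ENTCFCore) : (honestProver E).IsHonest :=
  ⟨exists_mass_prep_sub_le E, fun _ _ => rfl,
    fun n => (honestProver E).run_hadamardPreCircuit n,
    fun q n => (honestProver E).run_answerCircuit n q⟩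

/-! ### Decoding -/

namespace ENTCFCore

variable {E : ENTCFCore} {n : ℕ}

/-- `bHat` is an arbitrary choice, but the trapdoor recovers the bit from `y` alone, so every choice
gives the same bit. -/
theorem bHat_eq_some {kt : E.Key n × E.Trapdoor n} (hkt : kt ∈ (E.genG n).support) {y : E.Img n}
    {b : Bool} {x : E.Pre n} (h : E.Chk n false kt.1 y b x) : E.bHat n kt.1 y = some b := by
  have hex : ∃ b x, E.Chk n false kt.1 y b x := ⟨b, x, h⟩
  rw [bHat, dif_pos hex]
  obtain ⟨x', h'⟩ := hex.choose_spec
  have e := E.invG_spec n kt hkt _ _ h'.1 _ (by simpa [fn] using h'.2)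
  have e' := E.invG_spec n kt hkt _ _ h.1 _ (by simpa [fn] using h.2)
  exact congrArg some (congrArg Prod.fst (e.symm.trans e'))

theorem Chk.eq_inv {kt : E.Key n × E.Trapdoor n} (hkt : kt ∈ (E.genF n).support) {y : E.Img n}
    {b : Bool} {x : E.Pre n} (h : E.Chk n true kt.1 y b x) : E.invF n kt.2 b y = x :=
  E.invF_spec n kt hkt b x h.1 y (by simpa [fn] using h.2)

theorem chk_of_xHat_eq_some {θ b : Bool} {k : E.Key n} {y : E.Img n} {x : E.Pre n}
    (h : E.xHat n θ b k y = some x) : E.Chk n θ k y b x := by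
  unfold xHat at h
  split_ifs at h with hex
  exact Option.some.inj h ▸ hex.choose_spec

theorem xHat_ne_none {θ b : Bool} {k : E.Key n} {y : E.Img n} {x : E.Pre n}
    (h : E.Chk n θ k y b x) : E.xHat n θ b k y ≠ none := by
  rw [xHat, dif_pos ⟨x, h⟩]
  simp

/-- The partner under the perfect matching has the same image distribution, hence the same support.
Equality of distributions is recorded because amplitudes are compared later. -/
theorem exists_chk {kt : E.Key n × E.Trapdoor n} (hkt : kt ∈ (E.genF n).support) {y : E.Img n}
    {b : Bool} {x : E.Pre n} (h : E.Chk n true kt.1 y b x) (c : Bool) :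
    ∃ x', E.Chk n true kt.1 y c x' ∧ E.fn n true kt.1 c x' = E.fn n true kt.1 b x := by
  by_cases hc : c = b
  · subst hc; exact ⟨x, h, rfl⟩
  cases b <;> cases c <;> simp only [not_true_eq_false, reduceCtorEq, not_false_eq_true] at hc
  · obtain ⟨x', ⟨hx', hf⟩, -⟩ := E.matching_left n kt hkt x h.1
    have e : E.fn n true kt.1 true x' = E.fn n true kt.1 false x := by simp [fn, hf]
    exact ⟨x', ⟨hx', e ▸ h.2⟩, e⟩
  · obtain ⟨x', ⟨hx', hf⟩, -⟩ := E.matching_right n kt hkt x h.1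
    have e : E.fn n true kt.1 false x' = E.fn n true kt.1 true x := by simp [fn, hf]
    exact ⟨x', ⟨hx', e ▸ h.2⟩, e⟩

theorem exists_uHat {kt : E.Key n × E.Trapdoor n} (hkt : kt ∈ (E.genF n).support) {y : E.Img n}
    {b : Bool} {x : E.Pre n} (h : E.Chk n true kt.1 y b x) :
    ∃ x₀ x₁, E.xHat n true false kt.1 y = some x₀ ∧ E.xHat n true true kt.1 y = some x₁ := by
  obtain ⟨x₀, h₀, -⟩ := exists_chk hkt h false
  obtain ⟨x₁, h₁, -⟩ := exists_chk hkt h true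
  obtain ⟨x₀', e₀⟩ := Option.ne_none_iff_exists'.1 (xHat_ne_none h₀)
  obtain ⟨x₁', e₁⟩ := Option.ne_none_iff_exists'.1 (xHat_ne_none h₁)
  exact ⟨_, _, e₀, e₁⟩

/-- Exchanging the two elements of a claw. -/
theorem chk_xor {kt : E.Key n × E.Trapdoor n} (hkt : kt ∈ (E.genF n).support) {y : E.Img n}
    {x₀ x₁ : E.Pre n} (h₀ : E.xHat n true false kt.1 y = some x₀)
    (h₁ : E.xHat n true true kt.1 y = some x₁) {b : Bool} {x : E.Pre n}
    (h : E.Chk n true kt.1 y b x) :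
    E.Chk n true kt.1 y (!b) (xorBits x (xorBits x₀ x₁)) ∧
      E.fn n true kt.1 (!b) (xorBits x (xorBits x₀ x₁)) = E.fn n true kt.1 b x := by
  obtain ⟨x', h', e⟩ := exists_chk hkt h (!b)
  have e₀ := (chk_of_xHat_eq_some h₀).eq_inv hkt
  have e₁ := (chk_of_xHat_eq_some h₁).eq_inv hkt
  have hx := h.eq_inv hkt
  have hx' := h'.eq_inv hkt
  -- Inversion with the trapdoor makes preimages unique, so `x` and `x'` are `x₀` and `x₁` in the
  -- order given by `b`.
  have key : xorBits x (xorBits x₀ x₁) = x' := by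
    funext j
    cases b
    · rw [← hx, ← hx', ← e₀, ← e₁]; simp [xorBits]
    · rw [← hx, ← hx', ← e₀, ← e₁]; simp [xorBits, Bool.xor_left_comm]
  rw [key]
  exact ⟨h', e⟩

end ENTCFCore

/-! ### Acceptance in the ideal case -/

theorem flipMask_decide {ι : Type} [DecidableEq ι] (v : ι) (s : ι → Bool) :
    flipMask (fun u => decide (u = v)) s = flipBit v s := by
  funext u
  by_cases h : u = v
  · subst h; simp [flipMask, flipBit_apply]
  · simp [flipMask, flipBit_apply, h]

/-- The mask which flips `bit` and changes `pre` by `x`. -/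
def wireMask {l w m a : ℕ} (x : BitString w) : Wire l w m a → Bool
  | .bit => true
  | .pre j => x j
  | _ => false

namespace Prover

variable {E : ENTCFCore} (P : Prover E) (n : ℕ)

/-- The honest state after the images `y` have been measured. -/
def measured (θ : Fin 2 → Bool) (k : Fin 2 → E.Key n) (y : Fin 2 → E.Img n) :
    QState (P.Qubit n) :=
  postMeasure (fun s => P.imgOf n s = y) (P.honestState n θ k)

variable {P n} {θ : Fin 2 → Bool} {kt : Fin 2 → E.Key n × E.Trapdoor n} {y : Fin 2 → E.Img n}

/-- A nonzero amplitude requires a nonzero factor in each copy, hence a domain element and a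
positive probability of `y i`. -/
theorem chk_of_measured_ne_zero {k : Fin 2 → E.Key n} {s : P.Qubit n → Bool}
    (h : P.measured n θ k y s ≠ 0) (i : Fin 2) :
    E.Chk n (θ i) (k i) (y i) (P.bitOf n s i) (P.preOf n s i) := by
  by_cases hy : P.imgOf n s = y
  · rw [measured, postMeasure_of hy, honestState, Finset.prod_ne_zero_iff] at h
    have hi := h i (Finset.mem_univ i)
    split_ifs at hi with hc
    · refine ⟨hc.2.1, ?_⟩
      rw [← hy, PMF.mem_support_iff]
      intro h0
      rw [h0] at hi
      simp at hi
    · exact absurd rfl hi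
  · exact absurd (postMeasure_of_not hy) h

/-- The mask exchanges the two elements of the claw over `y i`. Both assign the same probability to
`y i`, so the amplitude does not change. -/
theorem measured_symmetric {i : Fin 2} (hθ : θ i = true) (hkt : kt i ∈ (E.genF n).support)
    {x₀ x₁ : E.Pre n} (h₀ : E.xHat n true false (kt i).1 (y i) = some x₀)
    (h₁ : E.xHat n true true (kt i).1 (y i) = some x₁) :
    Symmetric (fun v => decide (v.1 = i) && wireMask (xorBits x₀ x₁) v.2) (fun _ => 1)
      (P.measured n θ (fun i => (kt i).1) y) := by
  set x := xorBits x₀ x₁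
  set m : P.Qubit n → Bool := fun v => decide (v.1 = i) && wireMask x v.2
  have hkey : ∀ s, P.keyOf n (flipMask m s) = P.keyOf n s := fun s => by
    funext j c; simp [keyOf, flipMask, m, wireMask]
  have himg : ∀ s, P.imgOf n (flipMask m s) = P.imgOf n s := fun s => by
    funext j c; simp [imgOf, flipMask, m, wireMask]
  have hwork : ∀ s j c, flipMask m s (j, .work c) = s (j, .work c) := fun s j c => by
    simp [flipMask, m, wireMask]
  have hbit : ∀ s, P.bitOf n (flipMask m s) i = !P.bitOf n s i := fun s => by
    simp [bitOf, flipMask, m, wireMask]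
  have hpre : ∀ s, P.preOf n (flipMask m s) i = xorBits (P.preOf n s i) x := fun s => by
    funext c; simp [preOf, flipMask, m, wireMask, xorBits]
  have hbit' : ∀ s j, j ≠ i → P.bitOf n (flipMask m s) j = P.bitOf n s j := fun s j hj => by
    simp [bitOf, flipMask, m, hj]
  have hpre' : ∀ s j, j ≠ i → P.preOf n (flipMask m s) j = P.preOf n s j := fun s j hj => by
    funext c; simp [preOf, flipMask, m, hj]
  have hinv : ∀ s, flipMask m (flipMask m s) = s := fun s => by
    funext v; simp [flipMask]
  have main : ∀ s, P.measured n θ (fun i => (kt i).1) y s ≠ 0 →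
      P.measured n θ (fun i => (kt i).1) y (flipMask m s) =
        P.measured n θ (fun i => (kt i).1) y s := by
    intro s hs
    have hc := chk_of_measured_ne_zero hs i
    rw [hθ] at hc
    obtain ⟨hc', hf⟩ := ENTCFCore.chk_xor hkt h₀ h₁ hc
    by_cases hy : P.imgOf n s = y
    · rw [measured, postMeasure_of (s := s) hy, postMeasure_of ((himg s).trans hy), honestState,
        honestState]
      refine Finset.prod_congr rfl fun j _ => ?_
      by_cases hj : j = i
      · subst hj
        simp only [hkey, himg, hwork, hbit, hpre, hθ, hc.1, hc'.1, x, hf]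
      · simp only [hkey, himg, hwork, hbit' s j hj, hpre' s j hj]
    · exact absurd (postMeasure_of_not hy) hs
  intro s
  rw [one_mul]
  -- The mask is an involution, so a vanishing amplitude is handled by applying `main` to the
  -- flipped basis state.
  by_cases hs : P.measured n θ (fun i => (kt i).1) y s = 0
  · by_contra hne
    have := main (flipMask m s) (fun h0 => hne (h0.trans hs.symm))
    rw [hinv] at this
    exact hne this.symm
  · exact main s hs

variable (P n) in
/-- The honest state after the images `y` and then the strings `d` have been measured. -/
def measuredTwice (θ : Fin 2 → Bool) (k : Fin 2 → E.Key n) (y : Fin 2 → E.Img n)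
    (d : Fin 2 → E.Pre n) : QState (P.Qubit n) :=
  postMeasure (fun s => P.preOf n s = d) ((P.hadamardAll n).run (P.measured n θ k y))

variable {d : Fin 2 → E.Pre n}

/-- The Hadamard gates and the measurement act on `pre` only, so constraints on `bit` survive. -/
theorem measuredTwice_eq_zero {k : Fin 2 → E.Key n} {i : Fin 2} {R : Bool → Prop}
    (h : ∀ s, R (s (i, .bit)) → P.measured n θ k y s = 0) (s : P.Qubit n → Bool)
    (hs : R (s (i, .bit))) : P.measuredTwice n θ k y d s = 0 := by
  by_cases hd : P.preOf n s = d
  · rw [measuredTwice, postMeasure_of hd, hadamardAll_eq]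
    refine hadamards_eq_zero (P.preWires n) (P := fun s => R (s (i, .bit))) ?_ h s hs
    intro v hv s b hs
    obtain ⟨j, hj⟩ := (P.mem_preWires n).1 hv
    rwa [Function.update_of_ne]
    rintro rfl
    simp at hj
  · exact postMeasure_of_not hd

theorem measuredTwice_eq_zero_of_bHat {i : Fin 2} (hθ : θ i = false)
    (hkt : kt i ∈ (E.genG n).support) (s : P.Qubit n → Bool)
    (hs : E.bHat n (kt i).1 (y i) ≠ some (s (i, .bit))) :
    P.measuredTwice n θ (fun i => (kt i).1) y d s = 0 := by
  refine measuredTwice_eq_zero (i := i) (R := fun b => E.bHat n (kt i).1 (y i) ≠ some b)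
    (fun s hs => ?_) s hs
  by_contra h
  have hc := chk_of_measured_ne_zero h i
  rw [hθ] at hc
  exact hs (ENTCFCore.bHat_eq_some hkt hc)

theorem prod_preWires (i : Fin 2) (x : E.Pre n) (s : P.Qubit n → Bool) :
    ((P.preWires n).map fun v => sign ((decide (v.1 = i) && wireMask x v.2) && s v)).prod =
      sign (dotBit (P.preOf n s i) x) := by
  have h : ∀ j : Fin 2, ((List.finRange (E.preLen n)).map fun c =>
      sign ((decide (j = i) && x c) && s (j, .pre c))).prod =
        if j = i then sign (dotBit (P.preOf n s i) x) else 1 := by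
    intro j
    rw [← Fin.prod_univ_def]
    split_ifs with hj
    · subst hj
      rw [← prod_sign_eq_dotBit]
      simp [preOf]
    · simp [hj]
  have e : ((P.preWires n).map fun v =>
      sign ((decide (v.1 = i) && wireMask x v.2) && s v)).prod =
        ((List.finRange 2).map fun j => ((List.finRange (E.preLen n)).map fun c =>
          sign ((decide (j = i) && x c) && s (j, .pre c))).prod).prod := by
    simp [preWires, List.finRange_succ, Function.comp_def, wireMask]
  rw [e]
  simp only [h]
  rw [← Fin.prod_univ_def]
  simp

/-- The Hadamard gates on `pre` turn the `pre` part of the claw exchange into the sign `(-1)^(d ·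
(x₀ ⊕ x₁))`, which the measured `d` fixes. Only the flip of `bit` remains, with eigenvalue `(-1)^u`.
-/
theorem measuredTwice_flipBit {i : Fin 2} (hθ : θ i = true) (hkt : kt i ∈ (E.genF n).support)
    {u : Bool} (hu : E.uHat n (kt i).1 (y i) (d i) = some u) (s : P.Qubit n → Bool) :
    P.measuredTwice n θ (fun i => (kt i).1) y d (flipBit (i, .bit) s) =
      sign u * P.measuredTwice n θ (fun i => (kt i).1) y d s := by
  obtain ⟨x₀, x₁, h₀, h₁⟩ : ∃ x₀ x₁, E.xHat n true false (kt i).1 (y i) = some x₀ ∧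
      E.xHat n true true (kt i).1 (y i) = some x₁ := by
    unfold ENTCFCore.uHat at hu
    split at hu
    · exact ⟨_, _, ‹_›, ‹_›⟩
    · cases hu
  have hdot : dotBit (d i) (xorBits x₀ x₁) = u := by
    rw [ENTCFCore.uHat, h₀, h₁] at hu
    exact Option.some.inj hu
  have hpre : P.preOf n (flipBit (i, .bit) s) = P.preOf n s := by
    funext j c; simp [preOf, flipBit_apply]
  by_cases hd : P.preOf n s = d
  · have h := (measured_symmetric (P := P) hθ hkt h₀ h₁).hadamards
      (m' := fun v => decide (v = (i, .bit))) (P.preWires n) (P.nodup_preWires n)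
      (fun _ _ _ _ => rfl) (fun v hv => by
        obtain ⟨c, hc⟩ := (P.mem_preWires n).1 hv
        refine decide_eq_false ?_
        rintro rfl
        simp at hc)
      (fun v hv => by
        rw [mem_preWires] at hv
        obtain ⟨j, v⟩ := v
        cases v <;> simp [wireMask] at hv ⊢) s
    beta_reduce at h
    rw [flipMask_decide, prod_preWires, hd, hdot, one_mul] at h
    rw [measuredTwice, postMeasure_of (s := s) hd, postMeasure_of (hpre.trans hd), hadamardAll_eq, h]
  · rw [measuredTwice, postMeasure_of_not (s := s) hd, postMeasure_of_not (hpre ▸ hd), mul_zero]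

theorem exists_uHat_of_measuredTwice_ne_zero {i : Fin 2} (hθ : θ i = true)
    (hkt : kt i ∈ (E.genF n).support) {s : P.Qubit n → Bool}
    (hs : P.measuredTwice n θ (fun i => (kt i).1) y d s ≠ 0) :
    ∃ u, E.uHat n (kt i).1 (y i) (d i) = some u := by
  by_contra hu
  refine hs (measuredTwice_eq_zero (i := i) (R := fun _ => True) (fun t _ => ?_) s trivial)
  by_contra ht
  have hc := chk_of_measured_ne_zero ht i
  rw [hθ] at hc
  obtain ⟨x₀, x₁, h₀, h₁⟩ := ENTCFCore.exists_uHat hkt hc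
  exact hu ⟨_, by rw [ENTCFCore.uHat, h₀, h₁]⟩

theorem controlledZ_apply (ψ : QState (P.Qubit n)) (s : P.Qubit n → Bool) :
    P.controlledZ n ψ s = sign (s (0, .bit) && s (1, .bit)) * ψ s := by
  unfold controlledZ
  cases s (0, .bit) <;> cases s (1, .bit) <;> simp

/-- Conjugation by a controlled-`Z` gate turns `X` on one qubit into `X` on it times `Z` on the
other. -/
theorem controlledZ_symmetric {ψ : QState (P.Qubit n)} {i j : Fin 2} (hij : j ≠ i) {u : Bool}
    (h : ∀ s, ψ (flipBit (i, .bit) s) = sign u * ψ s) :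
    Symmetric (fun v => decide (v = (i, .bit))) (fun s => sign (xor u (s (j, .bit))))
      (P.controlledZ n ψ) := by
  intro s
  have hb : sign (flipBit ((i, .bit) : P.Qubit n) s (0, .bit) &&
      flipBit ((i, .bit) : P.Qubit n) s (1, .bit)) =
        sign (s (j, .bit)) * sign (s (0, .bit) && s (1, .bit)) := by
    fin_cases i <;> fin_cases j <;> simp [flipBit_apply] at hij ⊢ <;>
      cases s (0, .bit) <;> cases s (1, .bit) <;> simp
  beta_reduce
  rw [flipMask_decide, controlledZ_apply, controlledZ_apply, h, hb, sign_xor]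
  ring

variable (P n) in
/-- The qubits `bit` which are measured in the Hadamard basis. -/
def bitWires (q : Fin 2 → Bool) : List (P.Qubit n) :=
  (List.finRange 2).flatMap fun i => if q i = true then [(i, .bit)] else []

variable {q : Fin 2 → Bool}

theorem basisChange_eq : P.basisChange n q = (P.bitWires n q).map Gate.hadamard := by
  simp only [basisChange, bitWires, List.map_flatMap]
  congr 1
  funext i
  split_ifs <;> rfl

theorem mem_bitWires {v : P.Qubit n} : v ∈ P.bitWires n q ↔ q v.1 = true ∧ v.2 = .bit := by
  obtain ⟨i, v⟩ := v
  cases h0 : q 0 <;> cases h1 : q 1 <;> fin_cases i <;>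
    simp [bitWires, List.finRange_succ, h0, h1]

theorem nodup_bitWires : (P.bitWires n q).Nodup := by
  cases h0 : q 0 <;> cases h1 : q 1 <;> simp [bitWires, List.finRange_succ, h0, h1]

/-- The Hadamard gate on qubit `i` empties the mask, so the amplitude equals itself times `(-1)^(g s
+ s (i, .bit))`; if it is nonzero, the sign is `1`. -/
theorem sign_mul_sign_eq_one {ψ : QState (P.Qubit n)} {i : Fin 2} (hq : q i = true)
    {g : (P.Qubit n → Bool) → Bool}
    (h : Symmetric (fun v => decide (v = (i, .bit))) (fun s => sign (g s)) ψ)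
    (hg : ∀ v ∈ P.bitWires n q, ∀ s b, g (Function.update s v b) = g s)
    {s : P.Qubit n → Bool} (hs : (P.basisChange n q).run ψ s ≠ 0) : g s = s (i, .bit) := by
  have h1 := h.hadamards (m' := fun _ => false) (P.bitWires n q) nodup_bitWires
    (fun v hv s b => by rw [hg v hv]) (fun _ _ => rfl) (fun v hv => by
      refine (decide_eq_false ?_).symm
      rintro rfl
      exact hv (mem_bitWires.2 ⟨hq, rfl⟩)) s
  have hp : ((P.bitWires n q).map fun v => sign (decide (v = (i, .bit)) && s v)).prod =
      sign (s (i, .bit)) := by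
    fin_cases i <;> cases h0 : q 0 <;> cases h1 : q 1 <;> simp_all [bitWires, List.finRange_succ]
  have hf : flipMask (fun _ => false) s = s := by funext v; simp [flipMask]
  beta_reduce at h1
  rw [hf, hp, ← basisChange_eq] at h1
  exact eq_of_sign_mul_eq_one (mul_right_cancel₀ hs (h1.symm.trans (one_mul _).symm))

theorem basisChange_eq_zero {ψ : QState (P.Qubit n)} {i : Fin 2} (hq : q i = false)
    {R : Bool → Prop} (h : ∀ s, R (s (i, .bit)) → ψ s = 0) (s : P.Qubit n → Bool)
    (hs : R (s (i, .bit))) : (P.basisChange n q).run ψ s = 0 := by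
  rw [basisChange_eq]
  refine hadamards_eq_zero _ (P := fun s => R (s (i, .bit))) (fun v hv s b hs => ?_) h s hs
  rwa [Function.update_of_ne]
  rintro rfl
  rw [mem_bitWires, hq] at hv
  simp at hv

variable (P n) in
/-- The honest state before the last measurement in a Hadamard round. -/
def lastState (θ : Fin 2 → Bool) (k : Fin 2 → E.Key n) (y : Fin 2 → E.Img n)
    (d : Fin 2 → E.Pre n) (q : Fin 2 → Bool) : QState (P.Qubit n) :=
  (P.basisChange n q).run (P.controlledZ n (P.measuredTwice n θ k y d))

theorem exists_measuredTwice_ne_zero {k : Fin 2 → E.Key n} {s : P.Qubit n → Bool}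
    (hs : P.lastState n θ k y d q s ≠ 0) : ∃ t, P.measuredTwice n θ k y d t ≠ 0 := by
  by_contra! h
  have h0 : P.controlledZ n (P.measuredTwice n θ k y d) = 0 := by
    funext t; rw [controlledZ_apply, h, mul_zero]; rfl
  rw [lastState, h0, Circuit.run_zero] at hs
  exact hs rfl

/-! ### Correct answers on the support of the final state -/

section LastState

variable {i j : Fin 2} {s : P.Qubit n → Bool}
  (hs : P.lastState n θ (fun i => (kt i).1) y d q s ≠ 0)

include hs

theorem bHat_of_lastState_ne_zero (hθ : θ i = false) (hkt : kt i ∈ (E.genG n).support)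
    (hq : q i = false) : E.bHat n (kt i).1 (y i) = some (s (i, .bit)) := by
  by_contra h
  refine hs (basisChange_eq_zero hq (R := fun b => E.bHat n (kt i).1 (y i) ≠ some b) ?_ s h)
  intro t ht
  rw [controlledZ_apply, measuredTwice_eq_zero_of_bHat hθ hkt t ht, mul_zero]

/-- Qubit `j` is measured in the computational basis, so no Hadamard gate touches the bit in the
exponent and it is the answer itself. -/
theorem uHat_of_lastState_ne_zero (hij : j ≠ i) (hθ : θ i = true)
    (hkt : kt i ∈ (E.genF n).support) (hi : q i = true) (hj : q j = false) :
    E.uHat n (kt i).1 (y i) (d i) = some (xor (s (i, .bit)) (s (j, .bit))) := by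
  obtain ⟨t, ht⟩ := exists_measuredTwice_ne_zero hs
  obtain ⟨u, hu⟩ := exists_uHat_of_measuredTwice_ne_zero hθ hkt ht
  have h := controlledZ_symmetric hij (measuredTwice_flipBit (P := P) hθ hkt hu)
  have e := sign_mul_sign_eq_one hi h (fun v hv s b => by
    rw [Function.update_of_ne]
    rintro rfl
    rw [mem_bitWires, hj] at hv
    simp at hv) hs
  rw [hu, ← e]
  simp

/-- For an injective key at `j` the other bit is the constant `bHat` on the whole state before the
basis change. The sign is thus a constant, and the basis in which qubit `j` is measured does not
matter. -/
theorem exists_bHat_uHat_of_lastState_ne_zero (hij : j ≠ i) (hθ : θ i = true)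
    (hkt : kt i ∈ (E.genF n).support) (hi : q i = true) (hθ' : θ j = false)
    (hkt' : kt j ∈ (E.genG n).support) :
    ∃ b, E.bHat n (kt j).1 (y j) = some b ∧
      E.uHat n (kt i).1 (y i) (d i) = some (xor (s (i, .bit)) b) := by
  obtain ⟨t, ht⟩ := exists_measuredTwice_ne_zero hs
  obtain ⟨u, hu⟩ := exists_uHat_of_measuredTwice_ne_zero hθ hkt ht
  have hb : E.bHat n (kt j).1 (y j) = some (t (j, .bit)) := by
    by_contra h
    exact ht (measuredTwice_eq_zero_of_bHat hθ' hkt' t h)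
  have h := controlledZ_symmetric hij (measuredTwice_flipBit (P := P) hθ hkt hu)
  have h' : Symmetric (fun v => decide (v = (i, .bit))) (fun _ => sign (xor u (t (j, .bit))))
      (P.controlledZ n (P.measuredTwice n θ (fun i => (kt i).1) y d)) := by
    intro r
    rw [h r]
    beta_reduce
    by_cases hr : r (j, .bit) = t (j, .bit)
    · rw [hr]
    · have h0 := measuredTwice_eq_zero_of_bHat (P := P) (d := d) hθ' hkt' r
        (fun e => hr (Option.some.inj (e.symm.trans hb)))
      rw [controlledZ_apply, h0]
      simp
  have e := sign_mul_sign_eq_one hi h' (fun v hv s b => rfl) hs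
  refine ⟨_, hb, ?_⟩
  rw [hu, ← e]
  simp

theorem hadamardCheck_of_lastState_ne_zero (hkt : ∀ i, kt i ∈ (E.gen n (θ i)).support) :
    E.HadamardCheck n θ (fun i => (kt i).1) y d q (P.bitOf n s) := by
  have hG : ∀ i, θ i = false → kt i ∈ (E.genG n).support := fun i h => by
    simpa [ENTCFCore.gen, h] using hkt i
  have hF : ∀ i, θ i = true → kt i ∈ (E.genF n).support := fun i h => by
    simpa [ENTCFCore.gen, h] using hkt i
  have h01 : (0 : Fin 2) ≠ 1 := by decide
  unfold ENTCFCore.HadamardCheck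
  cases h0 : θ 0 <;> cases h1 : θ 1
  · trivial
  · exact ⟨bHat_of_lastState_ne_zero hs h0 (hG 0 h0), fun hq =>
      exists_bHat_uHat_of_lastState_ne_zero hs h01 h1 (hF 1 h1) hq h0 (hG 0 h0)⟩
  · exact ⟨fun hq =>
      exists_bHat_uHat_of_lastState_ne_zero hs h01.symm h0 (hF 0 h0) hq h1 (hG 1 h1),
      bHat_of_lastState_ne_zero hs h1 (hG 1 h1)⟩
  · exact ⟨fun hq => (uHat_of_lastState_ne_zero hs h01 h1 (hF 1 h1) hq.2 hq.1).trans
      (congrArg some (Bool.xor_comm _ _)),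
      fun hq => uHat_of_lastState_ne_zero hs h01.symm h0 (hF 0 h0) hq.1 hq.2⟩

end LastState

/-! ### Acceptance probabilities -/

variable (P) in
theorem abs_preimageAccept_sub_one_le (hP : P.IsHonest) (θ : Fin 2 → Bool)
    (k : Fin 2 → E.Key n) :
    |P.preimageAccept n θ k - 1| ≤
      mass ((P.prep n).run (P.input n k) - P.honestState n θ k) := by
  classical
  have h := abs_sum_mass_sub_le
    (Ω := (Fin 2 → E.Img n) × (Fin 2 → Bool) × (Fin 2 → E.Pre n))
    (fun o ψ => postMeasure (fun s => P.bitOf n s = o.2.1 ∧ P.preOf n s = o.2.2)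
      ((P.preimage n).run (postMeasure (fun s => P.imgOf n s = o.1) ψ)))
    (fun o ψ φ => by rw [postMeasure_sub, Circuit.run_sub, postMeasure_sub])
    (fun ψ => by
      rw [Fintype.sum_prod_type]
      have h : ∀ φ : QState (P.Qubit n), ∑ o : (Fin 2 → Bool) × (Fin 2 → E.Pre n),
          mass (postMeasure (fun s => P.bitOf n s = o.1 ∧ P.preOf n s = o.2) φ) = mass φ :=
        fun φ => by
          simpa only [Prod.ext_iff] using
            sum_mass_postMeasure (fun s => (P.bitOf n s, P.preOf n s)) φ
      simp only [h, Circuit.mass_run]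
      exact sum_mass_postMeasure (P.imgOf n) ψ)
    (fun o => ∀ i, E.Chk n (θ i) (k i) (o.1 i) (o.2.1 i) (o.2.2 i))
    ((P.prep n).run (P.input n k)) (P.honestState n θ k)
    (fun o ho => by
      rw [hP.2.1]
      funext s
      by_cases hs : P.bitOf n s = o.2.1 ∧ P.preOf n s = o.2.2
      · rw [postMeasure_of hs]
        by_contra hne
        refine ho fun i => ?_
        rw [← hs.1, ← hs.2]
        exact chk_of_measured_ne_zero hne i
      · rw [postMeasure_of_not hs]; rfl)
  rw [Circuit.mass_run, mass_input] at h
  simp only [Fintype.sum_prod_type] at h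
  exact h

variable (P) in
theorem abs_hadamardAccept_sub_one_le (hP : P.IsHonest) (θ : Fin 2 → Bool)
    (kt : Fin 2 → E.Key n × E.Trapdoor n) (hkt : ∀ i, kt i ∈ (E.gen n (θ i)).support) :
    |P.hadamardAccept n θ (fun i => (kt i).1) - 1| ≤
      mass ((P.prep n).run (P.input n fun i => (kt i).1) -
        P.honestState n θ (fun i => (kt i).1)) := by
  classical
  refine abs_average_sub_one_le (fun _ => by norm_num) (by simp) fun q _ => ?_
  have h := abs_sum_mass_sub_le
    (Ω := (Fin 2 → E.Img n) × (Fin 2 → E.Pre n) × (Fin 2 → Bool))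
    (fun o ψ => postMeasure (fun s => P.bitOf n s = o.2.2)
      ((P.answer q n).run (postMeasure (fun s => P.preOf n s = o.2.1)
        ((P.hadamard n).run (postMeasure (fun s => P.imgOf n s = o.1) ψ)))))
    (fun o ψ φ => by
      rw [postMeasure_sub, Circuit.run_sub, postMeasure_sub, Circuit.run_sub, postMeasure_sub])
    (fun ψ => by
      simp only [Fintype.sum_prod_type, sum_mass_postMeasure (P.bitOf n), Circuit.mass_run,
        sum_mass_postMeasure (P.preOf n), sum_mass_postMeasure (P.imgOf n)])
    (fun o => E.HadamardCheck n θ (fun i => (kt i).1) o.1 o.2.1 q o.2.2)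
    ((P.prep n).run (P.input n fun i => (kt i).1)) (P.honestState n θ fun i => (kt i).1)
    (fun o ho => by
      rw [hP.2.2.1, hP.2.2.2]
      funext s
      by_cases hs : P.bitOf n s = o.2.2
      · rw [postMeasure_of (p := fun s => P.bitOf n s = o.2.2) hs]
        by_contra hne
        rw [← hs] at ho
        exact ho (hadamardCheck_of_lastState_ne_zero hne hkt)
      · rw [postMeasure_of_not (p := fun s => P.bitOf n s = o.2.2) hs]; rfl)
  rw [Circuit.mass_run, mass_input] at h
  simp only [Fintype.sum_prod_type] at h
  exact h

/-- The preparation error itself serves as `ε`: it bounds the deviation in both round types for all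
generated keys, and averaging does not increase it. -/
theorem IsHonest.exists_abs_acceptProb_sub_one_le (hP : P.IsHonest) :
    ∃ ε : ℕ → ℝ, Negligible ε ∧ ∀ n, |P.acceptProb n - 1| ≤ ε n := by
  obtain ⟨ε, hε, h⟩ := hP.1
  refine ⟨ε, hε, fun n => ?_⟩
  refine abs_average_sub_one_le (fun _ => by norm_num) (by simp) fun θ _ => ?_
  refine abs_average_sub_one_le (fun kt => Finset.prod_nonneg fun _ _ => ENNReal.toReal_nonneg)
    ?_ fun kt hkt => ?_
  · have := Finset.prod_univ_sum (fun _ : Fin 2 => Finset.univ)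
      (fun i kt => (E.gen n (θ i) kt).toReal)
    rw [Fintype.piFinset_univ] at this
    rw [← this]
    exact Finset.prod_eq_one fun i _ => PMF.sum_toReal _
  · have hs : ∀ i, kt i ∈ (E.gen n (θ i)).support := fun i => by
      have := Finset.prod_ne_zero_iff.1 hkt i (Finset.mem_univ i)
      rw [PMF.mem_support_iff]
      intro h0
      rw [h0] at this
      exact this rfl
    have h1 := (P.abs_preimageAccept_sub_one_le hP θ fun i => (kt i).1).trans (h n θ kt hs)
    have h2 := (P.abs_hadamardAccept_sub_one_le hP θ kt hs).trans (h n θ kt hs)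
    rw [abs_le] at h1 h2 ⊢
    constructor <;> linarith [h1.1, h1.2, h2.1, h2.2]

end Prover

end

end SelfTest

theorem proposition3p1 (E : SelfTest.ENTCFCore) :
    ∃ P : SelfTest.Prover E, P.IsEfficient ∧ P.IsHonest ∧
      ∃ ε : ℕ → ℝ, SelfTest.Negligible ε ∧ ∀ n : ℕ, |P.acceptProb n - 1| ≤ ε n :=
  ⟨SelfTest.honestProver E, SelfTest.honestProver_isEfficient E,
    SelfTest.honestProver_isHonest E,
    (SelfTest.honestProver_isHonest E).exists_abs_acceptProb_sub_one_le⟩
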